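/- Let $X,Y,Z$ be the Pauli matrices. The family of observables $$\mathcal F_2=\{Z\otimes X,\ Z\}\cup\{\cos(\theta)X+\sin(\theta)Y:\theta\in[0,2\pi]\}$$ is (exactly) quantum universal, in the following sense. Let $\mathcal F$ be a family of observables with eigenvalues $\pm1$, each acting on finitely many qubits. A *measurement program* over $\mathcal F$ on a register of qubits is a classical flowchart with finitely many control locations. At each location the program either stops with a classical result, or performs the projective measurement of an observable $O\in\mathcal F$ on chosen distinct qubits of the register (projections $\frac{1}{2}(I\pm O)$, tensored with the identity on the other qubits) and moves to a location that depends on the outcome; loops are allowed. An operation on $n$ qubits is given by matrices $(A_k)_k$, where $k$ is the classical result and a state $\varphi$ becomes $A_k\varphi$ up to normalization; a unitary $U$ is the operation with the single matrix $U$, and a projective measurement is given by orthogonal projections $(P_k)_{k}$, finite in number, with $\sum_kP_k=I$. The family $\mathcal F$ *simulates* $(A_k)_k$ if there are $m\ge 0$ and a measurement program over $\mathcal F$ on $n+m$ qubits (the $n$ given qubits and $m$ auxiliary ones) such that 1. from every initial state, the program stops with probability one; 2. for every sequence of outcomes after which the program stops, with result $k$ say, let $B$ be the product of the corresponding projections.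 Then for every initial state $\chi$ of the auxiliary qubits there is a vector $\chi'$ such that $B(\varphi\otimes\chi)=(A_k\varphi)\otimes\chi'$ for all states $\varphi$ of the $n$ qubits. The family $\mathcal F$ is *quantum universal* if, for every $n\ge 0$, it simulates every unitary transformation of $n$ qubits and every projective measurement on $n$ qubits. -/

import Mathlib

open scoped Matrix

noncomputable section

namespace MBQC

/-- Operators on a register whose qubits are labelled by `ι`, as matrices in the computational
basis `ι → Fin 2`. -/
abbrev Op (ι : Type) := Matrix (ι → Fin 2) (ι → Fin 2) ℂ

/-- (Not necessarily normalized) state vectors of a register. -/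
abbrev Vec (ι : Type) := (ι → Fin 2) → ℂ

/-- The product state `φ ⊗ χ` of two registers. -/
def tensorVec {ι κ : Type} (φ : Vec ι) (χ : Vec κ) : Vec (ι ⊕ κ) :=
  fun x => φ (fun i => x (Sum.inl i)) * χ (fun j => x (Sum.inr j))

/-- `M 0 ⊗ ⋯ ⊗ M (k-1)`. -/
def tensorOp {k : ℕ} (M : Fin k → Matrix (Fin 2) (Fin 2) ℂ) : Op (Fin k) :=
  fun x y => ∏ i, M i (x i) (y i)

/-- A `k`-qubit observable with eigenvalues in `{1, -1}`. -/
structure Observable (k : ℕ) where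
  mat : Op (Fin k)
  isHermitian : mat.IsHermitian
  mul_self : mat * mat = 1

theorem tensorOp_isHermitian {k : ℕ} {M : Fin k → Matrix (Fin 2) (Fin 2) ℂ}
    (h : ∀ i, (M i).IsHermitian) : (tensorOp M).IsHermitian := by
  ext x y
  simp only [tensorOp, Matrix.conjTranspose_apply, star_prod]
  exact Finset.prod_congr rfl fun i _ => (h i).apply (x i) (y i)

theorem tensorOp_mul_self {k : ℕ} {M : Fin k → Matrix (Fin 2) (Fin 2) ℂ}
    (h : ∀ i, M i * M i = 1) : tensorOp M * tensorOp M = 1 := by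
  ext x y
  have key : ∏ i, (M i * M i) (x i) (y i) = (tensorOp M * tensorOp M) x y := by
    simp only [Matrix.mul_apply, tensorOp, ← Finset.prod_mul_distrib]
    rw [Finset.prod_univ_sum]
    simp
  rw [← key]
  simp only [h, Matrix.one_apply]
  by_cases hxy : x = y
  · simp [hxy]
  · obtain ⟨i, hi⟩ := Function.ne_iff.mp hxy
    rw [if_neg hxy]
    exact Finset.prod_eq_zero (Finset.mem_univ i) (if_neg hi)

/-- The tensor product of one-qubit observables. -/
def Observable.tensor {k : ℕ} (M : Fin k → Matrix (Fin 2) (Fin 2) ℂ)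
    (h₁ : ∀ i, (M i).IsHermitian) (h₂ : ∀ i, M i * M i = 1) : Observable k :=
  ⟨tensorOp M, tensorOp_isHermitian h₁, tensorOp_mul_self h₂⟩

def pauliX : Matrix (Fin 2) (Fin 2) ℂ := !![0, 1; 1, 0]
def pauliY : Matrix (Fin 2) (Fin 2) ℂ := !![0, -Complex.I; Complex.I, 0]
def pauliZ : Matrix (Fin 2) (Fin 2) ℂ := !![1, 0; 0, -1]

/-- `cos θ X + sin θ Y`. -/
def planar (θ : ℝ) : Matrix (Fin 2) (Fin 2) ℂ :=
  (Real.cos θ : ℂ) • pauliX + (Real.sin θ : ℂ) • pauliY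

theorem pauliX_isHermitian : pauliX.IsHermitian := by
  ext i j; fin_cases i <;> fin_cases j <;> simp [pauliX]

theorem pauliZ_isHermitian : pauliZ.IsHermitian := by
  ext i j; fin_cases i <;> fin_cases j <;> simp [pauliZ]

theorem planar_isHermitian (θ : ℝ) : (planar θ).IsHermitian := by
  ext i j
  fin_cases i <;> fin_cases j <;>
    simp [planar, pauliX, pauliY, -Complex.ofReal_cos, -Complex.ofReal_sin]

theorem pauliX_mul_self : pauliX * pauliX = 1 := by
  ext i j; fin_cases i <;> fin_cases j <;> simp [pauliX]

theorem pauliZ_mul_self : pauliZ * pauliZ = 1 := by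
  ext i j; fin_cases i <;> fin_cases j <;> simp [pauliZ]

theorem planar_mul_self (θ : ℝ) : planar θ * planar θ = 1 := by
  have h : Complex.cos θ ^ 2 + Complex.sin θ ^ 2 = 1 := Complex.cos_sq_add_sin_sq _
  have hI : Complex.I ^ 2 = -1 := Complex.I_sq
  ext i j
  fin_cases i <;> fin_cases j <;>
    simp [planar, pauliX, pauliY, Matrix.mul_apply, Fin.sum_univ_two] <;>
    linear_combination h - (Complex.sin θ) ^ 2 * hI

/-- The two-qubit observable `Z ⊗ X`. -/
def obsZX : Observable 2 :=
  Observable.tensor ![pauliZ, pauliX]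
    (by intro i; fin_cases i; exacts [pauliZ_isHermitian, pauliX_isHermitian])
    (by intro i; fin_cases i; exacts [pauliZ_mul_self, pauliX_mul_self])

/-- The one-qubit observable `Z`. -/
def obsZ : Observable 1 :=
  Observable.tensor (fun _ => pauliZ) (fun _ => pauliZ_isHermitian) (fun _ => pauliZ_mul_self)

/-- The one-qubit observable `cos θ X + sin θ Y`. -/
def obsPlanar (θ : ℝ) : Observable 1 :=
  Observable.tensor (fun _ => planar θ) (fun _ => planar_isHermitian θ)
    (fun _ => planar_mul_self θ)

/-- The family `{Z ⊗ X, Z} ∪ {cos θ X + sin θ Y : θ ∈ [0, 2π]}`. -/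
def F2 : Set (Σ k, Observable k) :=
  {⟨2, obsZX⟩, ⟨1, obsZ⟩} ∪
    (fun θ : ℝ => (⟨1, obsPlanar θ⟩ : Σ k, Observable k)) '' Set.Icc 0 (2 * Real.pi)

open Classical in
/-- The `k`-qubit operator `M` acting on the qubits `e 0, …, e (k-1)` of a register, tensored with
the identity on all other qubits. -/
def onQubits {ι : Type} {k : ℕ} (e : Fin k ↪ ι) (M : Op (Fin k)) : Op ι :=
  fun x y => if ∀ i, i ∉ Set.range e → x i = y i then M (fun j => x (e j)) (fun j => y (e j)) else 0

/-- The spectral projection of the observable `O`, measured on the qubits `e`, for the outcome `+1`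
(`s = true`) or `-1` (`s = false`). -/
def outcomeProj {ι : Type} [Fintype ι] [DecidableEq ι] {k : ℕ} (O : Observable k) (e : Fin k ↪ ι)
    (s : Bool) : Op ι :=
  (1 / 2 : ℂ) • (1 + (if s then (1 : ℂ) else -1) • onQubits e O.mat)

/-- An instruction of a measurement program on the register `ι`, with control locations `Q` and
classical results `κ`: either stop with a classical result, or measure an observable of `F` on some
qubits and go to a location that depends on the outcome. -/
inductive Instr (F : Set (Σ k, Observable k)) (ι κ Q : Type) : Type
  | halt (result : κ) : Instr F ι κ Q
  | measure (O : Σ k, Observable k) (hO : O ∈ F) (e : Fin O.1 ↪ ι) (next : Bool → Q) :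
      Instr F ι κ Q

/-- A classically controlled combination of measurements of observables of `F`: a flowchart with
finitely many control locations. Loops are allowed. -/
structure Program (F : Set (Σ k, Observable k)) (ι κ : Type) where
  Q : Type
  finite : Finite Q
  start : Q
  instr : Q → Instr F ι κ Q

variable {F : Set (Σ k, Observable k)} {ι κ : Type} [Fintype ι] [DecidableEq ι]

/-- `P.HaltsWith q k B`: there is a sequence of outcomes along which `P`, started at `q`, stops with
classical result `k`, and `B` is the product of the projections for these outcomes; that is, the
initial state `ψ` becomes the unnormalized state `B ψ`. -/
inductive Program.HaltsWith (P : Program F ι κ) : P.Q → κ → Op ι → Prop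
  | halt {q : P.Q} {k : κ} (h : P.instr q = .halt k) : Program.HaltsWith P q k 1
  | measure {q : P.Q} {O : Σ k, Observable k} {hO : O ∈ F} {e : Fin O.1 ↪ ι} {next : Bool → P.Q}
      (h : P.instr q = .measure O hO e next) (s : Bool) {k : κ} {B : Op ι}
      (hB : Program.HaltsWith P (next s) k B) :
      Program.HaltsWith P q k (B * outcomeProj O.2 e s)

/-- The probability (Born rule, scaled by the squared norm of `ψ`) that `P`, started at `q` in the
state `ψ`, has not stopped after `t` measurements. -/
def Program.runningProb (P : Program F ι κ) : ℕ → P.Q → Vec ι → ℝ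
  | 0, q, ψ =>
    match P.instr q with
    | .halt _ => 0
    | .measure _ _ _ _ => ∑ x, ‖ψ x‖ ^ 2
  | t + 1, q, ψ =>
    match P.instr q with
    | .halt _ => 0
    | .measure O _ e next => ∑ s : Bool, P.runningProb t (next s) (outcomeProj O.2 e s *ᵥ ψ)

/-- The family `F` simulates, exactly, the operation on `n` qubits which has the possible classical
results `k : κ` and transforms the state `φ` into `A k φ` (up to a scalar) when the result is `k`.
There are `m` auxiliary qubits and a program that stops with probability one; whatever the
initial state `χ` of the auxiliary qubits, whenever it stops, with result `k`, the `n` qubits are in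
the state `A k φ` up to a scalar and in product with the auxiliary qubits. The state `χ'`, into
which the scalar is absorbed, does not depend on `φ`. -/
def Simulates (F : Set (Σ k, Observable k)) {n : ℕ} {κ : Type} (A : κ → Op (Fin n)) : Prop :=
  ∃ (m : ℕ) (P : Program F (Fin n ⊕ Fin m) κ),
    (∀ ψ : Vec (Fin n ⊕ Fin m),
      Filter.Tendsto (fun t => P.runningProb t P.start ψ) Filter.atTop (nhds 0)) ∧
    ∀ (k : κ) (B : Op (Fin n ⊕ Fin m)), P.HaltsWith P.start k B →
      ∀ χ : Vec (Fin m), ∃ χ' : Vec (Fin m), ∀ φ : Vec (Fin n),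
        B *ᵥ tensorVec φ χ = tensorVec (A k *ᵥ φ) χ'

/-- `F` is (exactly) quantum universal: it simulates every unitary transformation and every
projective measurement on any number of qubits. -/
def IsQuantumUniversal (F : Set (Σ k, Observable k)) : Prop :=
  ∀ n : ℕ,
    (∀ U ∈ Matrix.unitaryGroup (Fin n → Fin 2) ℂ, Simulates F (fun _ : Unit => U)) ∧
    (∀ (r : ℕ) (p : Fin r → Op (Fin n)), (∀ k, IsStarProjection (p k)) → ∑ k, p k = 1 →
      Simulates F p)

end MBQC

end

/-!
Measuring `A ⊗ N` between two measurements of an ancilla applies a combination of `1` and `A`, up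
to a byproduct operator that depends on the outcomes. If the ancilla observables are `O` twice, with
`O N = - N O`, the combination is `1` or `A`, and repeating until `A` occurs applies `A`
almost surely. This gives `X` and `Z`, hence the correction of the byproducts of other measurement
patterns: the angle of the last measurement, adapted to the earlier outcomes, gives all rotations
about the `X` axis, and two joint measurements give the controlled not. The Hadamard gate is a
product of quarter turns and conjugates the `X` rotations to `Z` rotations.

Conjugating `Z` rotations by controlled nots gives `exp (i α w)` for every Walsh function `w`. The
Walsh functions span all functions of the basis states, so all diagonal unitaries are obtained.
Together with the `X` rotations they move every vector to a multiple of a basis state, one qubit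
after another. Conjugation then yields all complex reflections, and these generate the unitary
group.

To measure a projection `p`, apply the unitary `(1 - p) + p X`, with `X` acting on an ancilla,
between two measurements of the `Z` observable of the ancilla. A measurement with several outcomes
is a sequence of such measurements.
-/

noncomputable section

namespace MBQC

section SpectralProjections

/-- The eigenvalue `1` or `-1` of an observable, as encoded by a measurement outcome. -/
def sgn (s : Bool) : ℂ := if s then 1 else -1

@[simp] theorem sgn_true : sgn true = 1 := rfl

@[simp] theorem sgn_false : sgn false = -1 := rfl

@[simp] theorem sgn_not (s : Bool) : sgn (!s) = -sgn s := by cases s <;> simp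

@[simp] theorem sgn_mul_self (s : Bool) : sgn s * sgn s = 1 := by cases s <;> simp

@[simp] theorem star_sgn (s : Bool) : star (sgn s) = sgn s := by cases s <;> simp

theorem sgn_mul_sgn (s t : Bool) : sgn s * sgn t = sgn (s == t) := by cases s <;> cases t <;> simp

variable {A B : Type*} [Ring A] [Algebra ℂ A] [Ring B] [Algebra ℂ B] {O O' : A}

/-- The projection onto the eigenspace of an involution `O` for the eigenvalue `sgn s`. -/
def specProj (O : A) (s : Bool) : A := (1 / 2 : ℂ) • (1 + sgn s • O)

theorem map_specProj {F : Type*} [FunLike F A B] [AlgHomClass F ℂ A B] (f : F) (O : A) (s : Bool) :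
    f (specProj O s) = specProj (f O) s := by
  simp only [specProj, map_smul, map_add, map_one]

theorem sum_specProj (O : A) : ∑ s, specProj O s = 1 := by
  simp only [Fintype.sum_bool, specProj, sgn_true, sgn_false]
  module

theorem specProj_not (O : A) (s : Bool) : specProj O (!s) = 1 - specProj O s := by
  simp only [specProj, sgn_not]
  module

theorem mul_specProj (hO : O * O = 1) (s : Bool) : O * specProj O s = sgn s • specProj O s := by
  simp only [specProj, mul_smul_comm, mul_add, mul_one, hO]
  match_scalars <;> cases s <;> simp

theorem specProj_mul (hO : O * O = 1) (s : Bool) : specProj O s * O = sgn s • specProj O s := by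
  simp only [specProj, smul_mul_assoc, add_mul, one_mul, hO]
  match_scalars <;> cases s <;> simp

theorem isIdempotentElem_specProj (hO : O * O = 1) (s : Bool) :
    IsIdempotentElem (specProj O s) := by
  have h : specProj O s * specProj O s =
      (1 / 2 : ℂ) • (specProj O s + sgn s • (O * specProj O s)) := by
    nth_rewrite 1 [specProj]
    simp only [smul_mul_assoc, add_mul, one_mul]
  rw [IsIdempotentElem, h, mul_specProj hO, smul_smul, sgn_mul_self]
  module

theorem isStarProjection_specProj [StarRing A] [StarModule ℂ A] (hO : O * O = 1)
    (hsa : IsSelfAdjoint O) (s : Bool) : IsStarProjection (specProj O s) :=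
  ⟨isIdempotentElem_specProj hO s, by
    simp [IsSelfAdjoint, specProj, star_smul, hsa.star_eq, -Complex.star_def]⟩

theorem specProj_not_mul_specProj (hO : O * O = 1) (s : Bool) :
    specProj O (!s) * specProj O s = 0 := by
  rw [specProj_not, sub_mul, one_mul, (isIdempotentElem_specProj hO s).eq, sub_self]

theorem mul_specProj_of_anticomm (h : O' * O = -(O * O')) (s : Bool) :
    O' * specProj O s = specProj O (!s) * O' := by
  simp only [specProj, sgn_not, mul_smul_comm, smul_mul_assoc, mul_add, add_mul, mul_one, one_mul,
    h, smul_neg, neg_smul, neg_mul]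

theorem specProj_mul_mul_specProj_of_anticomm (hO : O * O = 1) (h : O' * O = -(O * O'))
    (s : Bool) : specProj O s * O' * specProj O s = 0 := by
  rw [mul_assoc, mul_specProj_of_anticomm h, ← mul_assoc]
  simpa using congrArg (· * O') (specProj_not_mul_specProj hO (!s))

theorem specProj_conj_of_anticomm (hO : O * O = 1) (h : O' * O = -(O * O')) (s r : Bool) :
    specProj O s * specProj O' r * specProj O s = (1 / 2 : ℂ) • specProj O s := by
  rw [specProj.eq_def O' r]
  simp only [mul_smul_comm, smul_mul_assoc, mul_add, add_mul, mul_one,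
    (isIdempotentElem_specProj hO s).eq, specProj_mul_mul_specProj_of_anticomm hO h, smul_zero,
    add_zero]

theorem specProj_not_conj_of_anticomm (hO : O * O = 1) (h : O' * O = -(O * O')) (s r : Bool) :
    specProj O (!s) * specProj O' r * specProj O s = (sgn r / 2) • (O' * specProj O s) := by
  have hswap : specProj O (!s) * O' * specProj O s = O' * specProj O s := by
    rw [← mul_specProj_of_anticomm h, mul_assoc, (isIdempotentElem_specProj hO s).eq]
  rw [specProj.eq_def O' r]
  simp only [mul_smul_comm, smul_mul_assoc, mul_add, add_mul, mul_one,
    specProj_not_mul_specProj hO, hswap, zero_add, smul_smul]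
  congr 1
  ring

end SpectralProjections

section PhaseGates

variable {A B : Type*} [Ring A] [Algebra ℂ A] [Ring B] [Algebra ℂ B] {X Z : A} {v : ℂ}

/-- The gate that multiplies the `-1` eigenspace of an involution `Z` by `v` and fixes the `+1`
eigenspace. -/
def phaseGate (Z : A) (v : ℂ) : A := specProj Z true + v • specProj Z false

theorem map_phaseGate {F : Type*} [FunLike F A B] [AlgHomClass F ℂ A B] (f : F) (Z : A) (v : ℂ) :
    f (phaseGate Z v) = phaseGate (f Z) v := by
  simp only [phaseGate, map_add, map_smul, map_specProj]

theorem phaseGate_one (Z : A) : phaseGate Z 1 = 1 := by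
  rw [phaseGate, one_smul, ← sum_specProj Z, Fintype.sum_bool]

theorem phaseGate_mul_phaseGate (hZ : Z * Z = 1) (v w : ℂ) :
    phaseGate Z v * phaseGate Z w = phaseGate Z (v * w) := by
  have h₁ : specProj Z true * specProj Z false = 0 := specProj_not_mul_specProj hZ false
  have h₂ : specProj Z false * specProj Z true = 0 := specProj_not_mul_specProj hZ true
  simp only [phaseGate, add_mul, mul_add, smul_mul_assoc, mul_smul_comm, h₁, h₂, smul_zero,
    add_zero, zero_add, (isIdempotentElem_specProj hZ _).eq, smul_smul, mul_comm w]

theorem star_phaseGate [StarRing A] [StarModule ℂ A] (hZ : Z * Z = 1) (hsa : IsSelfAdjoint Z)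
    (v : ℂ) : star (phaseGate Z v) = phaseGate Z (star v) := by
  simp only [phaseGate, star_add, star_smul,
    (isStarProjection_specProj hZ hsa _).isSelfAdjoint.star_eq]

theorem phaseGate_mem_unitary [StarRing A] [StarModule ℂ A] (hZ : Z * Z = 1)
    (hsa : IsSelfAdjoint Z) (hv : ‖v‖ = 1) : phaseGate Z v ∈ unitary A := by
  have hv' : star v * v = 1 := by simp [RCLike.conj_mul, hv]
  rw [Unitary.mem_iff, star_phaseGate hZ hsa, phaseGate_mul_phaseGate hZ,
    phaseGate_mul_phaseGate hZ, mul_comm v, hv', phaseGate_one]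
  exact ⟨rfl, rfl⟩

theorem phaseGate_neg_I (Z : A) :
    phaseGate Z (-Complex.I) = ((1 - Complex.I) / 2) • (1 + Complex.I • Z) := by
  simp only [phaseGate, specProj, sgn_true, sgn_false]
  match_scalars
  · ring
  · linear_combination (1 / 2 : ℂ) * Complex.I_sq

theorem phaseGate_neg_I_mul_mul (hX : X * X = 1) (hXZ : X * Z = -(Z * X)) :
    phaseGate X (-Complex.I) * phaseGate Z (-Complex.I) * phaseGate X (-Complex.I) =
      ((1 - Complex.I) / 2) • (X + Z) := by
  have hXZX : X * Z * X = -Z := by rw [hXZ, neg_mul, mul_assoc, hX, mul_one]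
  have hexpand : (1 + Complex.I • X) * (1 + Complex.I • Z) * (1 + Complex.I • X) =
      (1 + Complex.I ^ 2) • (1 : A) + (2 * Complex.I) • X + Complex.I • Z +
        Complex.I ^ 2 • (X * Z + Z * X) + Complex.I ^ 3 • (X * Z * X) := by
    simp only [smul_mul_assoc, mul_smul_comm, add_mul, mul_add, one_mul, mul_one, hX]
    module
  rw [hXZX, hXZ, neg_add_cancel, Complex.I_sq, Complex.I_pow_three, add_neg_cancel, zero_smul,
    smul_zero, zero_add, add_zero, neg_smul_neg] at hexpand
  simp only [phaseGate_neg_I, smul_mul_assoc, mul_smul_comm, hexpand]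
  match_scalars <;> linear_combination ((1 - Complex.I) * (Complex.I - 2) / 4) * Complex.I_sq

/-- For anticommuting involutions `X` and `Z`, the operator `X + Z` is `√2` times the
Hadamard gate. -/
theorem add_mul_phaseGate_mul_add (hX : X * X = 1) (hZ : Z * Z = 1) (hXZ : X * Z = -(Z * X))
    (v : ℂ) : (X + Z) * phaseGate X v * (X + Z) = (2 : ℂ) • phaseGate Z v := by
  have hswap : (X + Z) * X = Z * (X + Z) := by rw [add_mul, mul_add, hX, hZ, add_comm]
  have hsq : (X + Z) * (X + Z) = (2 : ℂ) • (1 : A) := by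
    rw [add_mul, mul_add, mul_add, hX, hZ, hXZ]
    module
  have hpass : (X + Z) * phaseGate X v = phaseGate Z v * (X + Z) := by
    simp only [phaseGate, specProj, mul_add (X + Z), add_mul _ _ (X + Z), mul_smul_comm,
      smul_mul_assoc, hswap, mul_one, one_mul]
  rw [hpass, mul_assoc, hsq, mul_smul_comm, mul_one]

end PhaseGates

section Controlled

variable {A : Type*} [Ring A] {P X : A}

/-- The operator `X` controlled on the range of the projection `P`. -/
def controlled (P X : A) : A := 1 - P + P * X

theorem controlled_mul_self (hP : IsIdempotentElem P) (hX : X * X = 1) (hPX : Commute P X) :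
    controlled P X * controlled P X = 1 := by
  have hPXP : P * X * P = P * X := by rw [mul_assoc, ← hPX.eq, ← mul_assoc, hP.eq]
  have hPXX : P * X * X = P := by rw [mul_assoc, hX, mul_one]
  simp only [controlled, add_mul, mul_add, sub_mul, mul_sub, one_mul, mul_one, hP.eq, hPXP, hPXX,
    ← mul_assoc]
  abel

theorem isSelfAdjoint_controlled [StarRing A] (hP : IsSelfAdjoint P) (hX : IsSelfAdjoint X)
    (hPX : Commute P X) : IsSelfAdjoint (controlled P X) :=
  ((IsSelfAdjoint.one A).sub hP).add ((hP.commute_iff hX).mp hPX)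

theorem controlled_mem_unitary [StarRing A] (hP : IsStarProjection P) (hX : X * X = 1)
    (hXsa : IsSelfAdjoint X) (hPX : Commute P X) : controlled P X ∈ unitary A := by
  rw [Unitary.mem_iff, (isSelfAdjoint_controlled hP.isSelfAdjoint hXsa hPX).star_eq]
  exact ⟨controlled_mul_self hP.isIdempotentElem hX hPX,
    controlled_mul_self hP.isIdempotentElem hX hPX⟩

end Controlled

section Amplify

open scoped Kronecker

variable {n m k : Type*} [Fintype n] [DecidableEq n] [Fintype m] [DecidableEq m] [Fintype k]
  [DecidableEq k]

/-- The operators `M ⊗ 1`, for an identification `s` of a basis with a product basis. -/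
def amplify (s : n ≃ m × k) : Matrix m m ℂ →⋆ₐ[ℂ] Matrix n n ℂ where
  toFun M := (M ⊗ₖ (1 : Matrix k k ℂ)).submatrix s s
  map_one' := by simp
  map_mul' M N := by
    rw [Matrix.submatrix_mul_equiv, ← Matrix.mul_kronecker_mul, mul_one]
  map_zero' := by simp
  map_add' M N := by rw [Matrix.add_kronecker, Matrix.submatrix_add, Pi.add_apply, Pi.add_apply]
  commutes' c := by
    rw [Algebra.algebraMap_eq_smul_one, Matrix.smul_kronecker, Matrix.one_kronecker_one]
    simp [Matrix.submatrix_smul, Algebra.algebraMap_eq_smul_one]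
  map_star' M := by
    simp [Matrix.star_eq_conjTranspose, Matrix.conjTranspose_kronecker]

theorem amplify_apply (s : n ≃ m × k) (M : Matrix m m ℂ) (x y : n) :
    amplify s M x y = if (s x).2 = (s y).2 then M (s x).1 (s y).1 else 0 := by
  change M (s x).1 (s y).1 * (1 : Matrix k k ℂ) (s x).2 (s y).2 = _
  rw [Matrix.one_apply, mul_ite, mul_one, mul_zero]

theorem amplify_mulVec (s : n ≃ m × k) (M : Matrix m m ℂ) (v : n → ℂ) (x : n) :
    (amplify s M *ᵥ v) x = ∑ b, M (s x).1 b * v (s.symm (b, (s x).2)) := by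
  simp only [Matrix.mulVec, dotProduct, amplify_apply]
  rw [← s.symm.sum_comp, Fintype.sum_prod_type]
  simp

end Amplify

section Local

variable {ι : Type} [Fintype ι] [DecidableEq ι]

/-- The one-qubit operator `M` acting on the qubit `q` of a register. -/
def loc (q : ι) : Matrix (Fin 2) (Fin 2) ℂ →⋆ₐ[ℂ] Op ι :=
  amplify (Equiv.funSplitAt q (Fin 2))

theorem loc_apply (q : ι) (M : Matrix (Fin 2) (Fin 2) ℂ) (x y : ι → Fin 2) :
    loc q M x y = if ∀ i, i ≠ q → x i = y i then M (x q) (y q) else 0 := by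
  simp [loc, amplify_apply, funext_iff]

theorem loc_mulVec (q : ι) (M : Matrix (Fin 2) (Fin 2) ℂ) (v : Vec ι) (x : ι → Fin 2) :
    (loc q M *ᵥ v) x = ∑ b, M (x q) b * v (Function.update x q b) := by
  rw [loc, amplify_mulVec]
  refine Finset.sum_congr rfl fun b _ => ?_
  congr 2

theorem loc_mul_apply (q : ι) (M : Matrix (Fin 2) (Fin 2) ℂ) (A : Op ι) (x y : ι → Fin 2) :
    (loc q M * A) x y = ∑ b, M (x q) b * A (Function.update x q b) y :=
  loc_mulVec q M (fun z => A z y) x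

theorem mul_loc_apply (q : ι) (M : Matrix (Fin 2) (Fin 2) ℂ) (A : Op ι) (x y : ι → Fin 2) :
    (A * loc q M) x y = ∑ b, A x (Function.update y q b) * M b (y q) := by
  have h := congrArg star (loc_mul_apply q (star M) (star A) y x)
  rw [map_star, ← star_mul, Matrix.star_apply, star_star, star_sum] at h
  rw [h]
  refine Finset.sum_congr rfl fun b _ => ?_
  rw [star_mul, Matrix.star_apply, Matrix.star_apply, star_star, star_star]

theorem loc_diagonal (q : ι) (d : Fin 2 → ℂ) :
    loc q (Matrix.diagonal d) = Matrix.diagonal fun x => d (x q) := by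
  ext x y
  rw [loc_apply]
  by_cases hxy : x = y
  · simp [hxy]
  rw [Matrix.diagonal_apply_ne _ hxy]
  split_ifs with h
  · refine Matrix.diagonal_apply_ne _ fun hq => hxy (funext fun i => ?_)
    by_cases hi : i = q
    · rw [hi, hq]
    · exact h i hi
  · rfl

end Local

section Embed

variable {ι R R' : Type} [Fintype ι] [DecidableEq ι] [Fintype R] [DecidableEq R] [Fintype R']
  [DecidableEq R']

/-- The operator `A` on a register `ι` acting on the qubits `e i` of a register `R`. -/
def embed (e : ι ↪ R) : Op ι →⋆ₐ[ℂ] Op R :=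
  amplify ((Equiv.piEquivPiSubtypeProd (· ∈ Set.range e) fun _ => Fin 2).trans
    (((Equiv.ofInjective e e.injective).arrowCongr (Equiv.refl _)).symm.prodCongr (Equiv.refl _)))

theorem embed_apply (e : ι ↪ R) (A : Op ι) (x y : R → Fin 2) :
    embed e A x y = if ∀ i, i ∉ Set.range e → x i = y i then A (x ∘ e) (y ∘ e) else 0 := by
  rw [embed, amplify_apply]
  refine if_congr ?_ rfl rfl
  simp [funext_iff]

theorem onQubits_eq_embed {k : ℕ} (e : Fin k ↪ R) (M : Op (Fin k)) : onQubits e M = embed e M := by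
  ext x y
  rw [embed_apply, onQubits]
  congr

theorem embed_embed (f : R ↪ R') (e : ι ↪ R) (A : Op ι) :
    embed f (embed e A) = embed (e.trans f) A := by
  ext x y
  simp only [embed_apply, ← ite_and]
  refine if_congr ?_ rfl rfl
  simp only [Set.mem_range, Function.Embedding.trans_apply]
  grind

theorem embed_loc (e : ι ↪ R) (q : ι) (M : Matrix (Fin 2) (Fin 2) ℂ) :
    embed e (loc q M) = loc (e q) M := by
  ext x y
  simp only [embed_apply, loc_apply, ← ite_and]
  refine if_congr ?_ rfl rfl
  grind

theorem embed_mul_loc_apply (e : ι ↪ R) {a : R} (ha : a ∉ Set.range e) (A : Op ι)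
    (M : Matrix (Fin 2) (Fin 2) ℂ) (x y : R → Fin 2) :
    (embed e A * loc a M) x y =
      if ∀ i, i ∉ Set.range e → i ≠ a → x i = y i then A (x ∘ e) (y ∘ e) * M (x a) (y a)
      else 0 := by
  have hcomp (b : Fin 2) : Function.update y a b ∘ e = y ∘ e :=
    funext fun i => Function.update_of_ne (fun h => ha ⟨i, h⟩) _ _
  rw [mul_loc_apply, Finset.sum_eq_single (x a)]
  · rw [embed_apply, hcomp, ite_mul, zero_mul]
    refine if_congr ?_ rfl rfl
    grind
  · intro b _ hb
    rw [embed_apply, if_neg fun h => hb ?_, zero_mul]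
    simpa using (h a ha).symm
  · simp

theorem commute_embed_loc (e : ι ↪ R) {a : R} (ha : a ∉ Set.range e) (A : Op ι)
    (M : Matrix (Fin 2) (Fin 2) ℂ) : Commute (embed e A) (loc a M) := by
  ext x y
  have h := congrArg star (embed_mul_loc_apply e ha (star A) (star M) y x)
  rw [map_star, map_star, ← star_mul, Matrix.star_apply, star_star] at h
  rw [embed_mul_loc_apply e ha, h, apply_ite star, star_mul, Matrix.star_apply, Matrix.star_apply,
    star_star, star_star, star_zero, mul_comm]
  simp only [eq_comm]

theorem commute_loc {p q : ι} (hpq : p ≠ q) (M N : Matrix (Fin 2) (Fin 2) ℂ) :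
    Commute (loc p M) (loc q N) := by
  have h := embed_loc (Function.Embedding.subtype (· ≠ q)) ⟨p, hpq⟩ M
  rw [Function.Embedding.subtype_apply] at h
  exact h ▸ commute_embed_loc _ (by simp) _ N

theorem embed_mul_loc_mul (e : ι ↪ R) {a : R} (ha : a ∉ Set.range e) (A B : Op ι)
    (M N : Matrix (Fin 2) (Fin 2) ℂ) :
    embed e A * loc a M * (embed e B * loc a N) = embed e (A * B) * loc a (M * N) := by
  rw [(commute_embed_loc e ha B M).symm.mul_mul_mul_comm, ← map_mul, ← map_mul]

theorem onQubits_tensorOp_one (e : Fin 1 ↪ R) (M : Matrix (Fin 2) (Fin 2) ℂ) :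
    onQubits e (tensorOp fun _ => M) = loc (e 0) M := by
  have h : (tensorOp fun _ => M : Op (Fin 1)) = loc 0 M := by
    ext x y
    simp [tensorOp, loc_apply]
  rw [onQubits_eq_embed, h, embed_loc]

theorem onQubits_tensorOp_two (e : Fin 2 ↪ R) (M N : Matrix (Fin 2) (Fin 2) ℂ) :
    onQubits e (tensorOp ![M, N]) = loc (e 0) M * loc (e 1) N := by
  have h : tensorOp ![M, N] = loc 0 M * loc 1 N := by
    ext x y
    rw [loc_mul_apply, Finset.sum_eq_single (y 0)]
    · simp [tensorOp, loc_apply, Fin.forall_fin_two]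
    · intro b _ hb
      rw [loc_apply, if_neg fun h => hb ?_, mul_zero]
      simpa using h 0 (by simp)
    · simp
  rw [onQubits_eq_embed, h, map_mul, embed_loc, embed_loc]

theorem embed_inl_mulVec_tensorVec (A : Op ι) (φ : Vec ι) (χ : Vec R) :
    embed Function.Embedding.inl A *ᵥ tensorVec φ χ = tensorVec (A *ᵥ φ) χ := by
  ext x
  simp only [Matrix.mulVec, dotProduct, tensorVec, embed_apply]
  rw [← (Equiv.sumArrowEquivProdArrow ι R (Fin 2)).symm.sum_comp, Fintype.sum_prod_type,
    Finset.sum_mul]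
  refine Finset.sum_congr rfl fun a _ => ?_
  rw [Finset.sum_eq_single (x ∘ Sum.inr)]
  · simp [mul_assoc, Function.comp_def]
  · intro b _ hb
    rw [if_neg fun h => hb (funext fun j => ?_), zero_mul]
    simpa using (h (Sum.inr j) (by simp)).symm
  · simp

theorem embed_inr_mulVec_tensorVec (A : Op R) (φ : Vec ι) (χ : Vec R) :
    embed Function.Embedding.inr A *ᵥ tensorVec φ χ = tensorVec φ (A *ᵥ χ) := by
  ext x
  simp only [Matrix.mulVec, dotProduct, tensorVec, embed_apply]
  rw [← (Equiv.sumArrowEquivProdArrow ι R (Fin 2)).symm.sum_comp, Fintype.sum_prod_type_right,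
    Finset.mul_sum]
  refine Finset.sum_congr rfl fun b _ => ?_
  rw [Finset.sum_eq_single (x ∘ Sum.inl)]
  · simp [mul_left_comm, Function.comp_def]
  · intro a _ ha
    rw [if_neg fun h => ha (funext fun i => ?_), zero_mul]
    simpa using (h (Sum.inl i) (by simp)).symm
  · simp

end Embed

section NormSq

variable {n J : Type*} [Fintype n]

/-- The squared Euclidean norm, the unnormalized probability of the state `ψ` in the Born rule. -/
def normSq (ψ : n → ℂ) : ℝ := ∑ x, ‖ψ x‖ ^ 2

theorem normSq_nonneg (ψ : n → ℂ) : 0 ≤ normSq ψ :=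
  Finset.sum_nonneg fun _ _ => sq_nonneg _

theorem ofReal_normSq (ψ : n → ℂ) : (normSq ψ : ℂ) = star ψ ⬝ᵥ ψ := by
  simp [normSq, dotProduct, Complex.conj_mul']

theorem normSq_eq_zero {ψ : n → ℂ} : normSq ψ = 0 ↔ ψ = 0 := by
  simp [normSq, Finset.sum_eq_zero_iff_of_nonneg, funext_iff]

theorem normSq_smul (c : ℂ) (ψ : n → ℂ) : normSq (c • ψ) = ‖c‖ ^ 2 * normSq ψ := by
  simp [normSq, mul_pow, Finset.mul_sum]

theorem ofReal_normSq_mulVec (A : Matrix n n ℂ) (ψ : n → ℂ) :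
    (normSq (A *ᵥ ψ) : ℂ) = star ψ ⬝ᵥ (star A * A) *ᵥ ψ := by
  rw [ofReal_normSq, Matrix.star_mulVec, ← Matrix.dotProduct_mulVec, Matrix.mulVec_mulVec,
    Matrix.star_eq_conjTranspose]

theorem sum_normSq_mulVec [DecidableEq n] [Fintype J] {p : J → Matrix n n ℂ}
    (hp : ∀ k, IsStarProjection (p k)) (hsum : ∑ k, p k = 1) (ψ : n → ℂ) :
    ∑ k, normSq (p k *ᵥ ψ) = normSq ψ := by
  rw [← Complex.ofReal_inj, Complex.ofReal_sum]
  simp only [ofReal_normSq_mulVec, (hp _).isSelfAdjoint.star_eq, (hp _).isIdempotentElem.eq]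
  rw [← dotProduct_sum, ← Matrix.sum_mulVec, hsum, Matrix.one_mulVec, ofReal_normSq]

theorem normSq_mulVec_le_of_isStarProjection {p : Matrix n n ℂ} (hp : IsStarProjection p)
    (ψ : n → ℂ) : normSq (p *ᵥ ψ) ≤ normSq ψ := by
  classical
  have h := sum_normSq_mulVec (p := fun b : Bool => if b then p else 1 - p)
    (by rintro (_ | _); exacts [hp.one_sub, hp]) (by simp) ψ
  simp only [Fintype.sum_bool, if_true] at h
  linarith [normSq_nonneg ((if false = true then p else 1 - p) *ᵥ ψ)]

theorem mul_eq_zero_of_sum_eq_one [DecidableEq n] [Fintype J] {p : J → Matrix n n ℂ}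
    (hp : ∀ k, IsStarProjection (p k)) (hsum : ∑ k, p k = 1) {j k : J} (hjk : j ≠ k) :
    p j * p k = 0 := by
  classical
  refine Matrix.ext_iff_mulVec.mpr fun ψ => ?_
  have hk : p k *ᵥ (p k *ᵥ ψ) = p k *ᵥ ψ := by
    rw [Matrix.mulVec_mulVec, (hp k).isIdempotentElem.eq]
  have hsum_norm := sum_normSq_mulVec hp hsum (p k *ᵥ ψ)
  rw [← Finset.add_sum_erase _ _ (Finset.mem_univ k), hk, add_eq_left,
    Finset.sum_eq_zero_iff_of_nonneg fun _ _ => normSq_nonneg _] at hsum_norm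
  rw [Matrix.zero_mulVec, ← Matrix.mulVec_mulVec]
  exact normSq_eq_zero.mp (hsum_norm j (by simp [hjk]))

end NormSq

section Running

variable {F : Set (Σ k, Observable k)} {ι κ Q Q' : Type} [Fintype ι] [DecidableEq ι]

theorem onQubits_mul_self {k : ℕ} (O : Observable k) (e : Fin k ↪ ι) :
    onQubits e O.mat * onQubits e O.mat = 1 := by
  rw [onQubits_eq_embed, ← map_mul, O.mul_self, map_one]

theorem outcomeProj_eq_specProj {k : ℕ} (O : Observable k) (e : Fin k ↪ ι) (s : Bool) :
    outcomeProj O e s = specProj (onQubits e O.mat) s := rfl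

theorem isStarProjection_outcomeProj {k : ℕ} (O : Observable k) (e : Fin k ↪ ι) (s : Bool) :
    IsStarProjection (outcomeProj O e s) :=
  isStarProjection_specProj (onQubits_mul_self O e)
    (by rw [onQubits_eq_embed]; exact O.isHermitian.isSelfAdjoint.map _) s

theorem sum_normSq_outcomeProj_mulVec {k : ℕ} (O : Observable k) (e : Fin k ↪ ι) (ψ : Vec ι) :
    ∑ s, normSq (outcomeProj O e s *ᵥ ψ) = normSq ψ :=
  sum_normSq_mulVec (isStarProjection_outcomeProj O e) (sum_specProj _) ψ

/-- The sum of `f` over the outcomes of the instruction `I` executed in the state `ψ`, evaluated at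
the next location and the unnormalized post-measurement state. -/
def Instr.branchSum (I : Instr F ι κ Q) (f : Q → Vec ι → ℝ) (ψ : Vec ι) : ℝ :=
  match I with
  | .halt _ => 0
  | .measure O _ e next => ∑ s, f (next s) (outcomeProj O.2 e s *ᵥ ψ)

theorem Instr.branchSum_mono (I : Instr F ι κ Q) {f g : Q → Vec ι → ℝ} (hfg : f ≤ g)
    (ψ : Vec ι) : I.branchSum f ψ ≤ I.branchSum g ψ := by
  cases I with
  | halt => exact le_rfl
  | measure O hO e next => exact Finset.sum_le_sum fun s _ => hfg _ _

/-- The instruction `I` with its locations renamed by `g`. -/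
def Instr.map (g : Q → Q') (I : Instr F ι κ Q) : Instr F ι κ Q' :=
  match I with
  | .halt k => .halt k
  | .measure O hO e next => .measure O hO e (g ∘ next)

namespace Program

variable (P : Program F ι κ)

/-- The monotone operator whose iterates compute the running probabilities of `P`. -/
def step (f : P.Q → Vec ι → ℝ) (q : P.Q) (ψ : Vec ι) : ℝ := (P.instr q).branchSum f ψ

theorem step_mono : Monotone P.step := fun _ _ hfg q ψ => (P.instr q).branchSum_mono hfg ψ

theorem step_normSq_le : P.step (fun _ => normSq) ≤ fun _ => normSq := fun q ψ => by
  rw [step]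
  cases P.instr q with
  | halt => exact normSq_nonneg ψ
  | measure O hO e next => exact (sum_normSq_outcomeProj_mulVec O.2 e ψ).le

theorem runningProb_zero : P.runningProb 0 = P.step fun _ => normSq := by
  funext q ψ
  rw [runningProb, step]
  cases P.instr q with
  | halt => rfl
  | measure O hO e next => exact (sum_normSq_outcomeProj_mulVec O.2 e ψ).symm

theorem runningProb_succ (t : ℕ) : P.runningProb (t + 1) = P.step (P.runningProb t) := by
  funext q ψ
  rw [runningProb, step]
  cases P.instr q <;> rfl

theorem runningProb_eq_iterate (t : ℕ) :
    P.runningProb t = P.step^[t + 1] fun _ => normSq := by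
  induction t with
  | zero => exact P.runningProb_zero
  | succ t ih => rw [runningProb_succ, ih, ← Function.iterate_succ_apply' P.step]

theorem runningProb_antitone : Antitone P.runningProb := fun s t hst => by
  rw [runningProb_eq_iterate, runningProb_eq_iterate]
  exact P.step_mono.antitone_iterate_of_map_le P.step_normSq_le (Nat.succ_le_succ hst)

theorem runningProb_le_normSq (t : ℕ) (q : P.Q) (ψ : Vec ι) : P.runningProb t q ψ ≤ normSq ψ := by
  rw [runningProb_eq_iterate]
  exact P.step_mono.antitone_iterate_of_map_le P.step_normSq_le (Nat.zero_le (t + 1)) q ψ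

theorem runningProb_nonneg (t : ℕ) (q : P.Q) (ψ : Vec ι) : 0 ≤ P.runningProb t q ψ := by
  induction t generalizing q ψ with
  | zero =>
    rw [runningProb_zero, step]
    cases P.instr q with
    | halt => exact le_rfl
    | measure O hO e next => exact Finset.sum_nonneg fun s _ => normSq_nonneg _
  | succ t ih =>
    rw [runningProb_succ, step]
    cases P.instr q with
    | halt => exact le_rfl
    | measure O hO e next => exact Finset.sum_nonneg fun s _ => ih _ _

/-- Termination with probability one, uniformly in the initial state. -/
def Terminates : Prop :=
  ∀ ε > 0, ∃ t, ∀ ψ : Vec ι, P.runningProb t P.start ψ ≤ ε * normSq ψ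

variable {P}

theorem Terminates.tendsto (h : P.Terminates) (ψ : Vec ι) :
    Filter.Tendsto (fun t => P.runningProb t P.start ψ) Filter.atTop (nhds 0) := by
  refine tendsto_order.mpr
    ⟨fun b hb => .of_forall fun t => hb.trans_le (P.runningProb_nonneg t P.start ψ), fun b hb => ?_⟩
  have hpos : 0 < normSq ψ + 1 := add_pos_of_nonneg_of_pos (normSq_nonneg ψ) one_pos
  obtain ⟨t, ht⟩ := h (b / (normSq ψ + 1)) (div_pos hb hpos)
  filter_upwards [Filter.eventually_ge_atTop t] with u hu
  calc P.runningProb u P.start ψ ≤ P.runningProb t P.start ψ := P.runningProb_antitone hu _ _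
    _ ≤ b / (normSq ψ + 1) * normSq ψ := ht ψ
    _ < b / (normSq ψ + 1) * (normSq ψ + 1) := by gcongr; linarith
    _ = b := div_mul_cancel₀ b hpos.ne'

end Program

end Running

section Composition

variable {F : Set (Σ k, Observable k)} {ι κ κ' Q Q' : Type}

namespace Program

variable {P : Program F ι κ} {R : κ → Program F ι κ'} [Finite κ]

/-- The program that runs `P` and then, on the result `k` of `P`, runs `R k`. -/
def bind (P : Program F ι κ) (R : κ → Program F ι κ') : Program F ι κ' where
  Q := P.Q ⊕ Σ k, (R k).Q
  finite := by
    have := P.finite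
    have := fun k => (R k).finite
    infer_instance
  start := .inl P.start
  instr
    | .inl q =>
      match P.instr q with
      | .halt k => ((R k).instr (R k).start).map fun p => .inr ⟨k, p⟩
      | .measure O hO e next => .measure O hO e fun s => .inl (next s)
    | .inr ⟨k, q⟩ => ((R k).instr q).map fun p => .inr ⟨k, p⟩

/-- The location `q` of `P` as a location of `P.bind R`. -/
def bindInl (R : κ → Program F ι κ') (q : P.Q) : (P.bind R).Q := .inl q

/-- The location `q` of `R k` as a location of `P.bind R`. -/
def bindInr (P : Program F ι κ) (R : κ → Program F ι κ') (k : κ) (q : (R k).Q) : (P.bind R).Q :=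
  .inr ⟨k, q⟩

theorem bind_instr_bindInr (k : κ) (q : (R k).Q) :
    (P.bind R).instr (bindInr P R k q) = ((R k).instr q).map (bindInr P R k) := rfl

theorem bind_instr_bindInl_of_halt {q : P.Q} {k : κ} (h : P.instr q = .halt k) :
    (P.bind R).instr (bindInl R q) = ((R k).instr (R k).start).map (bindInr P R k) := by
  simp only [bind, bindInl, h]
  rfl

theorem bind_instr_bindInl_of_measure {q : P.Q} {O : Σ k, Observable k} {hO : O ∈ F}
    {e : Fin O.1 ↪ ι} {next : Bool → P.Q} (h : P.instr q = .measure O hO e next) :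
    (P.bind R).instr (bindInl R q) = .measure O hO e (bindInl R ∘ next) := by
  simp only [bind, bindInl, h]
  rfl

end Program

variable [Fintype ι] [DecidableEq ι]

theorem Instr.branchSum_map (g : Q → Q') (I : Instr F ι κ Q) (f : Q' → Vec ι → ℝ) :
    (I.map g).branchSum f = I.branchSum (f ∘ g) := by
  cases I <;> rfl

/-- The instruction `I` produces an operator in `T k` whenever the program stops with result `k`,
provided that it does so with an operator in `S q k` from every next location `q`. This is the
verification condition for an invariant `S` of a program. -/
def Instr.Establishes (I : Instr F ι κ Q) (S : Q → κ → Set (Op ι)) (T : κ → Set (Op ι)) : Prop :=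
  match I with
  | .halt k => 1 ∈ T k
  | .measure O _ e next => ∀ s k, ∀ B ∈ S (next s) k, B * outcomeProj O.2 e s ∈ T k

theorem Instr.establishes_map {g : Q → Q'} {I : Instr F ι κ Q} {S : Q' → κ → Set (Op ι)}
    {T : κ → Set (Op ι)} : (I.map g).Establishes S T ↔ I.Establishes (S ∘ g) T := by
  cases I <;> rfl

namespace Program

variable {P : Program F ι κ} {R : κ → Program F ι κ'}

theorem HaltsWith.mem {S : P.Q → κ → Set (Op ι)} (hS : ∀ q, (P.instr q).Establishes S (S q))
    {q : P.Q} {k : κ} {B : Op ι} (h : P.HaltsWith q k B) : B ∈ S q k := by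
  induction h with
  | @halt q k hq =>
    have hq' := hS q
    rwa [hq] at hq'
  | @measure q O hO e next hq s k B _ ih =>
    have hq' := hS q
    rw [hq] at hq'
    exact hq' s k B ih

theorem establishes_haltsWith (P : Program F ι κ) (q : P.Q) :
    (P.instr q).Establishes (fun q k => {B | P.HaltsWith q k B}) fun k =>
      {B | P.HaltsWith q k B} := by
  cases hq : P.instr q with
  | halt k => exact .halt hq
  | measure O hO e next => exact fun s k B hB => .measure hq s hB

variable [Finite κ]

theorem runningProb_bindInr (t : ℕ) (k : κ) (q : (R k).Q) :
    (P.bind R).runningProb t (bindInr P R k q) = (R k).runningProb t q := by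
  induction t generalizing q with
  | zero =>
    funext ψ
    rw [runningProb_zero, runningProb_zero, step, bind_instr_bindInr, Instr.branchSum_map]
    rfl
  | succ t ih =>
    funext ψ
    rw [runningProb_succ, runningProb_succ, step, bind_instr_bindInr, Instr.branchSum_map,
      Function.comp_def, funext ih, step]

theorem runningProb_bindInl_of_halt {q : P.Q} {k : κ} (h : P.instr q = .halt k) (t : ℕ) :
    (P.bind R).runningProb t (bindInl R q) = (R k).runningProb t (R k).start := by
  funext ψ
  rw [← runningProb_bindInr (P := P)]
  cases t <;> simp only [runningProb_zero, runningProb_succ, step, bind_instr_bindInl_of_halt h,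
    bind_instr_bindInr]

theorem runningProb_bindInl_le {T : ℕ} {ε : ℝ} (hε : 0 ≤ ε)
    (hR : ∀ k ψ, (R k).runningProb T (R k).start ψ ≤ ε * normSq ψ) (t : ℕ) (q : P.Q) (ψ : Vec ι) :
    (P.bind R).runningProb (T + t) (bindInl R q) ψ ≤ P.runningProb t q ψ + ε * normSq ψ := by
  induction t generalizing q ψ with
  | zero =>
    cases hq : P.instr q with
    | halt k =>
      rw [runningProb_bindInl_of_halt hq]
      exact le_add_of_nonneg_of_le (P.runningProb_nonneg _ _ _) (hR k ψ)
    | measure O hO e next =>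
      have hP : P.runningProb 0 q ψ = normSq ψ := by rw [runningProb, hq, normSq]
      rw [hP]
      exact le_add_of_le_of_nonneg (runningProb_le_normSq _ _ _ _)
        (mul_nonneg hε (normSq_nonneg ψ))
  | succ t ih =>
    cases hq : P.instr q with
    | halt k =>
      rw [runningProb_bindInl_of_halt hq]
      exact le_add_of_nonneg_of_le (P.runningProb_nonneg _ _ _)
        (((R k).runningProb_antitone (Nat.le_add_right T (t + 1)) _ ψ).trans (hR k ψ))
    | measure O hO e next =>
      rw [← add_assoc, runningProb_succ, runningProb_succ, step, step,
        bind_instr_bindInl_of_measure hq, hq]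
      calc ∑ s, (P.bind R).runningProb (T + t) (bindInl R (next s)) (outcomeProj O.2 e s *ᵥ ψ)
          ≤ ∑ s, (P.runningProb t (next s) (outcomeProj O.2 e s *ᵥ ψ) +
              ε * normSq (outcomeProj O.2 e s *ᵥ ψ)) := Finset.sum_le_sum fun s _ => ih _ _
        _ = ∑ s, P.runningProb t (next s) (outcomeProj O.2 e s *ᵥ ψ) + ε * normSq ψ := by
          rw [Finset.sum_add_distrib, ← Finset.mul_sum, sum_normSq_outcomeProj_mulVec]

theorem Terminates.bind (hP : P.Terminates) (hR : ∀ k, (R k).Terminates) :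
    (P.bind R).Terminates := fun ε hε => by
  obtain ⟨t, ht⟩ := hP (ε / 2) (half_pos hε)
  choose T hT using fun k => hR k (ε / 2) (half_pos hε)
  obtain ⟨T', hT'⟩ := Finite.exists_le T
  refine ⟨T' + t, fun ψ => ?_⟩
  calc (P.bind R).runningProb (T' + t) (bindInl R P.start) ψ
      ≤ P.runningProb t P.start ψ + ε / 2 * normSq ψ :=
        runningProb_bindInl_le (half_pos hε).le
          (fun k ψ => ((R k).runningProb_antitone (hT' k) _ ψ).trans (hT k ψ)) t P.start ψ
    _ ≤ ε / 2 * normSq ψ + ε / 2 * normSq ψ := by gcongr; exact ht ψ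
    _ = ε * normSq ψ := by ring

theorem HaltsWith.exists_of_bind {j : κ'} {D : Op ι}
    (h : (P.bind R).HaltsWith (P.bind R).start j D) :
    ∃ k B C, P.HaltsWith P.start k B ∧ (R k).HaltsWith (R k).start j C ∧ D = C * B := by
  let S : (P.bind R).Q → κ' → Set (Op ι)
    | .inl q, j => {D | ∃ k B C, P.HaltsWith q k B ∧ (R k).HaltsWith (R k).start j C ∧ D = C * B}
    | .inr ⟨k, q⟩, j => {C | (R k).HaltsWith q j C}
  suffices hS : ∀ q, ((P.bind R).instr q).Establishes S (S q) from h.mem hS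
  rintro (q | ⟨k, q⟩)
  · change ((P.bind R).instr (bindInl R q)).Establishes S (S (bindInl R q))
    cases hq : P.instr q with
    | halt k =>
      rw [bind_instr_bindInl_of_halt hq, Instr.establishes_map]
      cases hk : (R k).instr (R k).start with
      | halt j => exact ⟨k, 1, 1, .halt hq, .halt hk, (mul_one 1).symm⟩
      | measure O hO e next =>
        exact fun s j B hB => ⟨k, 1, _, .halt hq, .measure hk s hB, (mul_one _).symm⟩
    | measure O hO e next =>
      rw [bind_instr_bindInl_of_measure hq]
      rintro s j _ ⟨k, B, C, hB, hC, rfl⟩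
      exact ⟨k, _, C, .measure hq s hB, hC, mul_assoc _ _ _⟩
  · exact Instr.establishes_map.mpr ((R k).establishes_haltsWith q)

end Program

/-- Some program over `F` stops with probability one, and whenever it stops with result `k`, the
operator that it has applied belongs to `S k`. -/
def Realizable (F : Set (Σ k, Observable k)) (S : κ → Set (Op ι)) : Prop :=
  ∃ P : Program F ι κ, P.Terminates ∧ ∀ k B, P.HaltsWith P.start k B → B ∈ S k

namespace Realizable

variable {S T : κ → Set (Op ι)}

theorem mono (h : Realizable F S) (hST : ∀ k, S k ⊆ T k) : Realizable F T :=
  let ⟨P, hP, hB⟩ := h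
  ⟨P, hP, fun k B h => hST k (hB k B h)⟩

theorem halt {k : κ} (h : 1 ∈ S k) : Realizable F S := by
  let P : Program F ι κ := ⟨Unit, inferInstance, (), fun _ => .halt k⟩
  refine ⟨P, fun ε hε => ⟨0, fun ψ => mul_nonneg hε.le (normSq_nonneg ψ)⟩, fun j B hB => ?_⟩
  exact hB.mem (P := P) (S := fun _ => S) fun _ => h

theorem bind [Finite κ] {T : κ' → Set (Op ι)} (hS : Realizable F S)
    (hT : ∀ k, Realizable F fun j => {C | ∀ B ∈ S k, C * B ∈ T j}) : Realizable F T := by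
  obtain ⟨P, hP, hPS⟩ := hS
  choose R hR hRT using hT
  refine ⟨P.bind R, hP.bind hR, fun j D hD => ?_⟩
  obtain ⟨k, B, C, hB, hC, rfl⟩ := hD.exists_of_bind
  exact hRT k j C hC B (hPS k B hB)

end Realizable

/-- The operator `O` on a register is an observable of the family `F` acting on some qubits. -/
def CanMeasure (F : Set (Σ k, Observable k)) (O : Op ι) : Prop :=
  ∃ o ∈ F, ∃ e : Fin o.1 ↪ ι, onQubits e o.2.mat = O

theorem CanMeasure.mul_self {O : Op ι} (hO : CanMeasure F O) : O * O = 1 := by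
  obtain ⟨o, -, e, rfl⟩ := hO
  exact onQubits_mul_self o.2 e

theorem realizable_specProj {O : Op ι} (hO : CanMeasure F O) :
    Realizable F fun s => {specProj O s} := by
  obtain ⟨o, ho, e, rfl⟩ := hO
  let P : Program F ι Bool := ⟨Option Bool, inferInstance, none,
    fun q => q.elim (.measure o ho e some) .halt⟩
  refine ⟨P, fun ε hε => ⟨1, fun ψ => ?_⟩, fun s B hB => ?_⟩
  · calc P.runningProb 1 none ψ = 0 := by simp [Program.runningProb, P]
      _ ≤ ε * normSq ψ := mul_nonneg hε.le (normSq_nonneg ψ)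
  · let S : Option Bool → Bool → Set (Op ι)
      | none, s => {specProj (onQubits e o.2.mat) s}
      | some r, s => {B | B = 1 ∧ s = r}
    refine hB.mem (P := P) (S := S) ?_
    rintro (_ | r)
    · rintro s k B ⟨rfl, rfl⟩
      exact one_mul _
    · exact ⟨rfl, rfl⟩

theorem Realizable.measure {T : κ → Set (Op ι)} {O : Op ι} (hO : CanMeasure F O)
    (hT : ∀ s, Realizable F fun k => {B | B * specProj O s ∈ T k}) : Realizable F T :=
  (realizable_specProj hO).bind fun s => (hT s).mono fun _ _ hB _ hC => hC ▸ hB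

end Composition

section Flip

variable {F : Set (Σ k, Observable k)} {ι : Type}

/-- The program that measures `o'` and then `o`, and starts over as long as the outcome of the
latter is `t`. -/
abbrev flipLoop {o o' : Σ k, Observable k} (ho : o ∈ F) (ho' : o' ∈ F) (e : Fin o.1 ↪ ι)
    (e' : Fin o'.1 ↪ ι) (t : Bool) : Program F ι Unit where
  Q := Fin 3
  finite := inferInstance
  start := 0
  instr := ![.measure o' ho' e' fun _ => 1, .measure o ho e fun s => if s = t then 0 else 2,
    .halt ()]

variable [Fintype ι] [DecidableEq ι] {o o' : Σ k, Observable k} (ho : o ∈ F) (ho' : o' ∈ F)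
  {e : Fin o.1 ↪ ι} {e' : Fin o'.1 ↪ ι}

theorem runningProb_flipLoop_add_two (t : Bool) (n : ℕ) (ψ : Vec ι) :
    (flipLoop ho ho' e e' t).runningProb (n + 2) (0 : Fin 3) ψ =
      ∑ r, (flipLoop ho ho' e e' t).runningProb n (0 : Fin 3)
        (outcomeProj o.2 e t *ᵥ (outcomeProj o'.2 e' r *ᵥ ψ)) := by
  have hhalt (ψ : Vec ι) : (flipLoop ho ho' e e' t).runningProb n (2 : Fin 3) ψ = 0 := by
    cases n <;> rfl
  change ∑ r, ∑ s : Bool, (flipLoop ho ho' e e' t).runningProb n (if s = t then (0 : Fin 3) else 2)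
    (outcomeProj o.2 e s *ᵥ (outcomeProj o'.2 e' r *ᵥ ψ)) = _
  refine Finset.sum_congr rfl fun r _ => ?_
  cases t <;> simp [hhalt]

theorem runningProb_flipLoop_le
    (h : onQubits e' o'.2.mat * onQubits e o.2.mat = -(onQubits e o.2.mat * onQubits e' o'.2.mat))
    (t : Bool) (n : ℕ) (ψ : Vec ι) :
    (flipLoop ho ho' e e' t).runningProb (2 * n) (0 : Fin 3) (outcomeProj o.2 e t *ᵥ ψ) ≤
      (1 / 2) ^ n * normSq (outcomeProj o.2 e t *ᵥ ψ) := by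
  induction n generalizing ψ with
  | zero => simpa using (flipLoop ho ho' e e' t).runningProb_le_normSq 0 0 _
  | succ n ih =>
    have hreturn (r : Bool) : normSq (outcomeProj o.2 e t *ᵥ (outcomeProj o'.2 e' r *ᵥ
        (outcomeProj o.2 e t *ᵥ ψ))) = 1 / 4 * normSq (outcomeProj o.2 e t *ᵥ ψ) := by
      simp only [Matrix.mulVec_mulVec, ← mul_assoc, outcomeProj_eq_specProj,
        specProj_conj_of_anticomm (onQubits_mul_self o.2 e) h, Matrix.smul_mulVec, normSq_smul]
      norm_num
    calc _ = ∑ r, (flipLoop ho ho' e e' t).runningProb (2 * n) (0 : Fin 3) (outcomeProj o.2 e t *ᵥ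
            (outcomeProj o'.2 e' r *ᵥ (outcomeProj o.2 e t *ᵥ ψ))) :=
          runningProb_flipLoop_add_two ho ho' t _ _
      _ ≤ ∑ _ : Bool, (1 / 2) ^ n * (1 / 4 * normSq (outcomeProj o.2 e t *ᵥ ψ)) :=
          Finset.sum_le_sum fun r _ => (ih _).trans_eq (by rw [hreturn])
      _ = (1 / 2) ^ (n + 1) * normSq (outcomeProj o.2 e t *ᵥ ψ) := by
          rw [Fintype.sum_bool]
          ring

theorem terminates_flipLoop
    (h : onQubits e' o'.2.mat * onQubits e o.2.mat = -(onQubits e o.2.mat * onQubits e' o'.2.mat))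
    (t : Bool) : (flipLoop ho ho' e e' t).Terminates := fun ε hε => by
  obtain ⟨n, hn⟩ := exists_pow_lt_of_lt_one hε (by norm_num : (1 / 2 : ℝ) < 1)
  refine ⟨2 * n + 2, fun ψ => ?_⟩
  calc _ = ∑ r, (flipLoop ho ho' e e' t).runningProb (2 * n) (0 : Fin 3)
          (outcomeProj o.2 e t *ᵥ (outcomeProj o'.2 e' r *ᵥ ψ)) :=
        runningProb_flipLoop_add_two ho ho' t _ _
    _ ≤ ∑ r, (1 / 2) ^ n * normSq (outcomeProj o'.2 e' r *ᵥ ψ) := by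
        refine Finset.sum_le_sum fun r _ => (runningProb_flipLoop_le ho ho' h t n _).trans ?_
        gcongr
        exact normSq_mulVec_le_of_isStarProjection (isStarProjection_outcomeProj o.2 e t) _
    _ = (1 / 2) ^ n * normSq ψ := by rw [← Finset.mul_sum, sum_normSq_outcomeProj_mulVec]
    _ ≤ ε * normSq ψ := by gcongr; exact normSq_nonneg ψ

/-- Measuring `O'` between two measurements of an anticommuting observable `O` applies `O'` if the
two outcomes differ. Otherwise it applies a multiple of the projection, so it can be repeated. -/
theorem Realizable.flip {O O' : Op ι} (hO : CanMeasure F O) (hO' : CanMeasure F O')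
    (h : O' * O = -(O * O')) :
    Realizable F fun _ : Unit => {B | ∃ (c : ℂ) (t : Bool), B = c • (O' * specProj O t)} := by
  have hOO := hO.mul_self
  refine Realizable.measure hO fun t => ?_
  obtain ⟨o, ho, e, rfl⟩ := hO
  obtain ⟨o', ho', e', rfl⟩ := hO'
  set O := onQubits e o.2.mat
  set O' := onQubits e' o'.2.mat
  refine ⟨flipLoop ho ho' e e' t, terminates_flipLoop ho ho' h t, fun k B hB => ?_⟩
  let S (q : Fin 3) : Set (Op ι) := ![
    {B | ∃ c : ℂ, B * specProj O t = c • (O' * specProj O t)},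
    {B | ∀ r, ∃ c : ℂ, B * specProj O' r * specProj O t = c • (O' * specProj O t)}, {1}] q
  suffices hS : ∀ q, ((flipLoop ho ho' e e' t).instr q).Establishes (fun q _ => S q) fun _ => S q by
    obtain ⟨c, hc⟩ := hB.mem hS
    exact ⟨c, t, hc⟩
  refine Fin.forall_fin_succ.mpr ⟨fun r _ B hB => hB r, Fin.forall_fin_two.mpr
    ⟨fun s _ B hB r => ?_, rfl⟩⟩
  change B ∈ S (if s = t then 0 else 2) at hB
  change ∃ c : ℂ, B * specProj O s * specProj O' r * specProj O t = c • (O' * specProj O t)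
  obtain rfl | hs := eq_or_ne s t
  · rw [if_pos rfl] at hB
    obtain ⟨c, hc⟩ := hB
    refine ⟨1 / 2 * c, ?_⟩
    rw [mul_assoc, mul_assoc, ← mul_assoc (specProj _ _), specProj_conj_of_anticomm hOO h,
      mul_smul_comm, hc, smul_smul]
  · rw [if_neg hs] at hB
    obtain rfl : B = 1 := hB
    refine ⟨sgn r / 2, ?_⟩
    rw [one_mul, Bool.eq_not_of_ne hs, specProj_not_conj_of_anticomm hOO h]

end Flip

section Equatorial

/-- The observable `cos θ X + sin θ Y`, parametrized by the phase `u = exp (i θ)`. -/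
def equatorial (u : ℂ) : Matrix (Fin 2) (Fin 2) ℂ := !![0, star u; u, 0]

theorem equatorial_one : equatorial 1 = pauliX := by
  simp [equatorial, pauliX]

theorem planar_eq_equatorial (θ : ℝ) : planar θ = equatorial (Complex.exp (θ * Complex.I)) := by
  ext i j
  fin_cases i <;> fin_cases j <;>
    simp [planar, equatorial, pauliX, pauliY, Complex.exp_mul_I, ← Complex.cos_conj,
      ← Complex.sin_conj]

theorem pauliX_mul_pauliZ : pauliX * pauliZ = -(pauliZ * pauliX) := by
  ext i j
  fin_cases i <;> fin_cases j <;> simp [pauliX, pauliZ]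

variable {ι : Type} [Fintype ι] [DecidableEq ι]

theorem canMeasure_loc_pauliZ (q : ι) : CanMeasure F2 (loc q pauliZ) :=
  ⟨⟨1, obsZ⟩, .inl (.inr rfl), ⟨fun _ => q, Function.injective_of_subsingleton _⟩,
    onQubits_tensorOp_one _ _⟩

theorem canMeasure_loc_equatorial (q : ι) {u : ℂ} (hu : ‖u‖ = 1) :
    CanMeasure F2 (loc q (equatorial u)) := by
  have hexp : Complex.exp (toIcoMod Real.two_pi_pos 0 u.arg * Complex.I) = u := by
    rw [toIcoMod, Complex.ofReal_sub, sub_mul, Complex.exp_sub, zsmul_eq_mul]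
    push_cast
    rw [mul_assoc, Complex.exp_int_mul_two_pi_mul_I, div_one]
    simpa [hu] using Complex.norm_mul_exp_arg_mul_I u
  have hmem := toIcoMod_mem_Ico Real.two_pi_pos 0 u.arg
  rw [zero_add] at hmem
  refine ⟨⟨1, obsPlanar _⟩, .inr ⟨_, Set.Ico_subset_Icc_self hmem, rfl⟩,
    ⟨fun _ => q, Function.injective_of_subsingleton _⟩, (onQubits_tensorOp_one _ _).trans ?_⟩
  rw [planar_eq_equatorial, hexp]
  rfl

theorem canMeasure_loc_pauliX (q : ι) : CanMeasure F2 (loc q pauliX) :=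
  equatorial_one ▸ canMeasure_loc_equatorial q norm_one

theorem canMeasure_loc_pauliZ_mul_loc_pauliX {p q : ι} (hpq : p ≠ q) :
    CanMeasure F2 (loc p pauliZ * loc q pauliX) :=
  ⟨⟨2, obsZX⟩, .inl (.inl rfl), ⟨![p, q], List.nodup_ofFn.mp (by simpa using hpq)⟩,
    onQubits_tensorOp_two _ _ _⟩

end Equatorial

section Simulable

variable {ι R : Type} [Fintype ι] [DecidableEq ι] [Fintype R] [DecidableEq R] {e : ι ↪ R} {a : R}

/-- The operators that act as `U` on the qubits `e i` and arbitrarily on the qubit `a`. -/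
def productOps (e : ι ↪ R) (a : R) (U : Op ι) : Set (Op R) :=
  {B | ∃ K, B = embed e U * loc a K}

/-- The operator `U` on the qubits `e i` can be implemented, up to a scalar, by measurements in `F2`
that involve a single auxiliary qubit `a` in an arbitrary state. -/
def Simulable (e : ι ↪ R) (a : R) (U : Op ι) : Prop :=
  Realizable F2 fun _ : Unit => productOps e a U

theorem smul_mem_productOps {U : Op ι} {B : Op R} (c : ℂ) (hB : B ∈ productOps e a U) :
    c • B ∈ productOps e a U := by
  obtain ⟨K, rfl⟩ := hB
  exact ⟨c • K, by rw [map_smul, mul_smul_comm]⟩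

namespace Simulable

variable {U V W : Op ι}

theorem one : Simulable e a 1 :=
  .halt (k := ()) ⟨1, by rw [map_one, map_one, mul_one]⟩

theorem correct (ha : a ∉ Set.range e) (hV : Simulable e a V) {c : ℂ} (h : V * W = c • U)
    (K : Matrix (Fin 2) (Fin 2) ℂ) :
    Realizable F2 fun _ : Unit => {B | B * (embed e W * loc a K) ∈ productOps e a U} := by
  refine hV.mono fun _ B hB => ?_
  obtain ⟨L, rfl⟩ := hB
  rw [Set.mem_ofPred_eq, embed_mul_loc_mul e ha, h, map_smul, smul_mul_assoc]
  exact smul_mem_productOps c ⟨_, rfl⟩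

theorem mul (ha : a ∉ Set.range e) (hU : Simulable e a U) (hV : Simulable e a V) :
    Simulable e a (U * V) := by
  refine Realizable.bind hV fun _ => hU.mono ?_
  rintro _ _ ⟨K, rfl⟩ _ ⟨L, rfl⟩
  exact ⟨K * L, embed_mul_loc_mul e ha U V K L⟩

theorem of_smul {c : ℂ} (h : Simulable e a (c • U)) : Simulable e a U := by
  refine h.mono ?_
  rintro _ _ ⟨K, rfl⟩
  exact ⟨c • K, by simp only [map_smul, smul_mul_assoc, mul_smul_comm]⟩

end Simulable

end Simulable

section Gadgets

variable {ι R : Type} [Fintype ι] [DecidableEq ι] [Fintype R] [DecidableEq R] {e : ι ↪ R} {a : R}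

theorem loc_mul_embed_mul_loc_mul_loc (ha : a ∉ Set.range e)
    {p p' N K : Matrix (Fin 2) (Fin 2) ℂ} {c : ℂ} (h : p * N * p' = c • K) (A : Op ι) :
    loc a p * (embed e A * loc a N) * loc a p' = c • (embed e A * loc a K) := by
  rw [← mul_assoc (loc a p), (commute_embed_loc e ha A p).symm.eq, mul_assoc, mul_assoc,
    ← map_mul, ← map_mul, ← mul_assoc, h, map_smul, mul_smul_comm]

theorem loc_mul_specProj_mul_loc (ha : a ∉ Set.range e) {p p' N K : Matrix (Fin 2) (Fin 2) ℂ}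
    {α β : ℂ} (hK : p * p' = α • K) (hN : p * N * p' = β • K) (A : Op ι) (r : Bool) :
    loc a p * specProj (embed e A * loc a N) r * loc a p' =
      embed e ((1 / 2 : ℂ) • (α • 1 + (sgn r * β) • A)) * loc a K := by
  simp only [specProj, mul_smul_comm, smul_mul_assoc, mul_add, add_mul, mul_one,
    loc_mul_embed_mul_loc_mul_loc ha hN, map_smul, map_add, map_one, one_mul, ← map_mul, hK]
  module

theorem loc_mul_specProj_mul_specProj_mul_loc (ha : a ∉ Set.range e)
    {p p' M N K : Matrix (Fin 2) (Fin 2) ℂ} {α β γ δ : ℂ} (hK : p * p' = α • K)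
    (hM : p * M * p' = β • K) (hN : p * N * p' = γ • K) (hMN : p * (M * N) * p' = δ • K)
    (A B : Op ι) (r s : Bool) :
    loc a p * specProj (embed e A * loc a M) r * specProj (embed e B * loc a N) s * loc a p' =
      embed e ((1 / 4 : ℂ) • (α • 1 + (sgn r * β) • A + (sgn s * γ) • B +
        (sgn r * sgn s * δ) • (A * B))) * loc a K := by
  have hprod : specProj (embed e A * loc a M) r * specProj (embed e B * loc a N) s =
      (1 / 4 : ℂ) • (1 + sgn r • (embed e A * loc a M) + sgn s • (embed e B * loc a N) +
        (sgn r * sgn s) • (embed e (A * B) * loc a (M * N))) := by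
    rw [← embed_mul_loc_mul e ha]
    simp only [specProj, mul_smul_comm, smul_mul_assoc, mul_add, add_mul, mul_one, one_mul]
    module
  rw [mul_assoc (loc a p), hprod]
  simp only [mul_smul_comm, smul_mul_assoc, mul_add, add_mul, mul_one,
    loc_mul_embed_mul_loc_mul_loc ha hM, loc_mul_embed_mul_loc_mul_loc ha hN,
    loc_mul_embed_mul_loc_mul_loc ha hMN, map_smul, map_add, map_one, one_mul, ← map_mul, hK]
  module

end Gadgets

section OneQubitGates

variable {ι R : Type} [Fintype ι] [DecidableEq ι] [Fintype R] [DecidableEq R] {e : ι ↪ R} {a : R}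

theorem canMeasure_embed_pauliX_mul_loc_pauliZ (ha : a ∉ Set.range e) (q : ι) :
    CanMeasure F2 (embed e (loc q pauliX) * loc a pauliZ) := by
  rw [(commute_embed_loc e ha _ _).eq, embed_loc]
  exact canMeasure_loc_pauliZ_mul_loc_pauliX fun h => ha ⟨q, h.symm⟩

theorem canMeasure_embed_pauliZ_mul_loc_pauliX (ha : a ∉ Set.range e) (q : ι) :
    CanMeasure F2 (embed e (loc q pauliZ) * loc a pauliX) := by
  rw [embed_loc]
  exact canMeasure_loc_pauliZ_mul_loc_pauliX fun h => ha ⟨q, h⟩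

theorem Simulable.of_canMeasure_mul {A : Op ι} {N O : Matrix (Fin 2) (Fin 2) ℂ}
    (ha : a ∉ Set.range e) (hO : CanMeasure F2 (loc a O))
    (hA : CanMeasure F2 (embed e A * loc a N)) (hNO : N * O = -(O * N)) : Simulable e a A := by
  have hanti : embed e A * loc a N * loc a O = -(loc a O * (embed e A * loc a N)) := by
    rw [← mul_assoc (loc a O), (commute_embed_loc e ha A O).symm.eq, mul_assoc, mul_assoc,
      ← map_mul, ← map_mul, hNO, map_neg, mul_neg]
  refine (Realizable.flip hO hA hanti).mono ?_
  rintro _ _ ⟨c, t, rfl⟩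
  refine smul_mem_productOps c ⟨N * specProj O t, ?_⟩
  rw [mul_assoc, map_mul, map_specProj]

theorem Simulable.pauliZ (ha : a ∉ Set.range e) (q : ι) : Simulable e a (loc q MBQC.pauliZ) :=
  .of_canMeasure_mul ha (canMeasure_loc_pauliZ a) (canMeasure_embed_pauliZ_mul_loc_pauliX ha q)
    pauliX_mul_pauliZ

theorem Simulable.pauliX (ha : a ∉ Set.range e) (q : ι) : Simulable e a (loc q MBQC.pauliX) :=
  .of_canMeasure_mul ha (canMeasure_loc_pauliX a) (canMeasure_embed_pauliX_mul_loc_pauliZ ha q)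
    (by rw [pauliX_mul_pauliZ, neg_neg])

theorem loc_pauliX_mul_self (q : ι) : loc q pauliX * loc q pauliX = 1 := by
  rw [← map_mul, pauliX_mul_self, map_one]

theorem loc_pauliZ_mul_self (q : ι) : loc q pauliZ * loc q pauliZ = 1 := by
  rw [← map_mul, pauliZ_mul_self, map_one]

theorem specProj_equatorial {u : ℂ} (hu : star u * u = 1) (s : Bool) :
    specProj (equatorial u) s =
      (1 / 2 : ℂ) • Matrix.vecMulVec ![1, sgn s * u] ![1, sgn s * star u] := by
  have hu' : u * (starRingEnd ℂ) u = 1 := mul_comm (star u) u ▸ hu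
  ext i j
  fin_cases i <;> fin_cases j <;>
    simp [specProj, equatorial, mul_mul_mul_comm _ u, hu']

theorem specProj_equatorial_mul_mul_specProj_equatorial {u v : ℂ} (hu : star u * u = 1)
    (hv : star v * v = 1) (s t : Bool) (N : Matrix (Fin 2) (Fin 2) ℂ) :
    specProj (equatorial u) s * N * specProj (equatorial v) t =
      (![1, sgn s * star u] ⬝ᵥ N *ᵥ ![1, sgn t * v]) •
        (1 / 4 : ℂ) • Matrix.vecMulVec ![1, sgn s * u] ![1, sgn t * star v] := by
  rw [specProj_equatorial hu, specProj_equatorial hv, smul_mul_assoc, mul_smul_comm,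
    smul_mul_assoc, mul_assoc, Matrix.mul_vecMulVec, Matrix.vecMulVec_mul_vecMulVec,
    Matrix.vecMulVec_smul]
  module

theorem specProj_equatorial_mul_specProj_pauliX {u : ℂ} (hu : star u * u = 1) (t w : Bool) :
    specProj (equatorial u) t * specProj pauliX w = (1 + sgn (t == w) * star u) •
      (1 / 4 : ℂ) • Matrix.vecMulVec ![1, sgn t * u] ![1, sgn w] := by
  have h := specProj_equatorial_mul_mul_specProj_equatorial hu (v := 1) (by simp) t w 1
  rw [equatorial_one] at h
  simpa [← sgn_mul_sgn, mul_right_comm] using h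

theorem specProj_equatorial_mul_pauliZ_mul_specProj_pauliX {u : ℂ} (hu : star u * u = 1)
    (t w : Bool) :
    specProj (equatorial u) t * pauliZ * specProj pauliX w = (1 - sgn (t == w) * star u) •
      (1 / 4 : ℂ) • Matrix.vecMulVec ![1, sgn t * u] ![1, sgn w] := by
  have h := specProj_equatorial_mul_mul_specProj_equatorial hu (v := 1) (by simp) t w pauliZ
  rw [equatorial_one] at h
  simpa [← sgn_mul_sgn, mul_assoc, mul_left_comm (sgn w), pauliZ, Matrix.mulVec, Matrix.vecHead,
    Matrix.vecTail, sub_eq_add_neg] using h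

/-- The byproduct operator `X` is to be corrected if the first and the last outcome differ. -/
theorem exists_byproduct_mul_eq_smul_phaseGate {X : Op ι} (hX : X * X = 1) {v : ℂ}
    (hv : star v * v = 1) (r s : Bool) :
    ∃ c : ℂ, (if s then 1 else X) * ((1 / 2 : ℂ) • ((1 + sgn s * if r then v else star v) • 1 +
      (sgn r * (1 - sgn s * if r then v else star v)) • X)) = c • phaseGate X v := by
  refine ⟨if r then 1 else sgn s * star v, ?_⟩
  cases r <;> cases s <;>
    simp only [phaseGate, specProj, sgn_true, sgn_false, mul_smul_comm, mul_add, hX, one_mul,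
      mul_one, if_true, Bool.false_eq_true, if_false] <;>
    match_scalars <;> grind

theorem Simulable.phaseGate_pauliX (ha : a ∉ Set.range e) (q : ι) {v : ℂ} (hv : ‖v‖ = 1) :
    Simulable e a (phaseGate (loc q MBQC.pauliX) v) := by
  have hv' : star v * v = 1 := by simp [RCLike.conj_mul, hv]
  let u (r : Bool) : ℂ := if r then star v else v
  have hu (r : Bool) : ‖u r‖ = 1 := by cases r <;> simpa [u] using hv
  have hu' (r : Bool) : star (u r) * u r = 1 := by simp [RCLike.conj_mul, hu]
  have hstar (r : Bool) : star (u r) = if r then v else star v := by cases r <;> simp [u]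
  refine Realizable.measure (canMeasure_loc_pauliX a) fun w =>
    Realizable.measure (canMeasure_embed_pauliX_mul_loc_pauliZ ha q) fun r =>
    Realizable.measure (canMeasure_loc_equatorial a (hu r)) fun t => ?_
  have hV : Simulable e a (if t == w then 1 else loc q MBQC.pauliX) := by
    split
    exacts [.one, .pauliX ha q]
  obtain ⟨c, hc⟩ := exists_byproduct_mul_eq_smul_phaseGate (loc_pauliX_mul_self q) hv' r (t == w)
  have hop := loc_mul_specProj_mul_loc ha (specProj_equatorial_mul_specProj_pauliX (hu' r) t w)
    (specProj_equatorial_mul_pauliZ_mul_specProj_pauliX (hu' r) t w) (loc q MBQC.pauliX) r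
  rw [hstar, map_specProj, map_specProj] at hop
  simp only [Set.mem_ofPred_eq, mul_assoc] at hop ⊢
  rw [hop]
  exact hV.correct ha hc _

theorem equatorial_I_mul_pauliZ : equatorial Complex.I * pauliZ = Complex.I • pauliX := by
  ext i j
  fin_cases i <;> fin_cases j <;> simp [equatorial, pauliX, pauliZ]

theorem specProj_equatorial_I_mul_pauliX_mul_specProj_pauliZ (t w : Bool) :
    specProj (equatorial Complex.I) t * pauliX * specProj pauliZ w =
      (-(sgn (t == w) * Complex.I)) • (specProj (equatorial Complex.I) t * specProj pauliZ w) := by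
  have hY : equatorial Complex.I * equatorial Complex.I = 1 := by
    ext i j
    fin_cases i <;> fin_cases j <;> simp [equatorial]
  have hX : pauliX = -Complex.I • (equatorial Complex.I * pauliZ) := by
    rw [equatorial_I_mul_pauliZ, smul_smul]
    simp
  rw [hX, mul_smul_comm, smul_mul_assoc, ← mul_assoc, specProj_mul hY, mul_assoc,
    mul_specProj pauliZ_mul_self, ← sgn_mul_sgn, mul_smul_comm, smul_mul_assoc]
  module

theorem exists_byproduct_mul_eq_smul_phaseGate_neg_I {Z : Op ι} (hZ : Z * Z = 1) (s : Bool) :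
    ∃ c : ℂ, (if s then Z else 1) * ((1 / 2 : ℂ) • ((1 : ℂ) • 1 + (-(sgn s * Complex.I)) • Z)) =
      c • phaseGate Z (-Complex.I) := by
  have hI := Complex.I_sq
  refine ⟨if s then (1 - Complex.I) / 2 else (1 + Complex.I) / 2, ?_⟩
  rw [phaseGate_neg_I]
  cases s <;>
    simp only [sgn_true, sgn_false, mul_smul_comm, mul_add, hZ, one_mul, mul_one, if_true,
      Bool.false_eq_true, if_false] <;>
    match_scalars <;> grind

theorem Simulable.phaseGate_pauliZ_neg_I (ha : a ∉ Set.range e) (q : ι) :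
    Simulable e a (phaseGate (loc q MBQC.pauliZ) (-Complex.I)) := by
  refine Realizable.measure (canMeasure_loc_pauliZ a) fun w =>
    Realizable.measure (canMeasure_embed_pauliZ_mul_loc_pauliX ha q) fun r =>
    Realizable.measure (canMeasure_loc_equatorial a Complex.norm_I) fun t => ?_
  have hV : Simulable e a (if r == (t == w) then loc q MBQC.pauliZ else 1) := by
    split
    exacts [.pauliZ ha q, .one]
  obtain ⟨c, hc⟩ :=
    exists_byproduct_mul_eq_smul_phaseGate_neg_I (loc_pauliZ_mul_self q) (r == (t == w))
  have hop := loc_mul_specProj_mul_loc ha (one_smul ℂ _).symm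
    (specProj_equatorial_I_mul_pauliX_mul_specProj_pauliZ t w) (loc q MBQC.pauliZ) r
  rw [mul_neg, ← mul_assoc (sgn r), sgn_mul_sgn, map_specProj, map_specProj] at hop
  simp only [Set.mem_ofPred_eq, mul_assoc] at hop ⊢
  rw [hop]
  exact hV.correct ha hc _

theorem loc_pauliX_mul_loc_pauliZ (q : ι) :
    loc q pauliX * loc q pauliZ = -(loc q pauliZ * loc q pauliX) := by
  rw [← map_mul, ← map_mul, pauliX_mul_pauliZ, map_neg]

theorem Simulable.pauliX_add_pauliZ (ha : a ∉ Set.range e) (q : ι) :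
    Simulable e a (loc q MBQC.pauliX + loc q MBQC.pauliZ) := by
  have hX : Simulable e a (phaseGate (loc q MBQC.pauliX) (-Complex.I)) :=
    .phaseGate_pauliX ha q (by simp)
  have h := (hX.mul ha (.phaseGate_pauliZ_neg_I ha q)).mul ha hX
  rw [phaseGate_neg_I_mul_mul (loc_pauliX_mul_self q) (loc_pauliX_mul_loc_pauliZ q)] at h
  exact h.of_smul

theorem Simulable.phaseGate_pauliZ (ha : a ∉ Set.range e) (q : ι) {v : ℂ} (hv : ‖v‖ = 1) :
    Simulable e a (phaseGate (loc q MBQC.pauliZ) v) := by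
  have hH := Simulable.pauliX_add_pauliZ ha q
  have h := (hH.mul ha (.phaseGate_pauliX ha q hv)).mul ha hH
  rw [add_mul_phaseGate_mul_add (loc_pauliX_mul_self q) (loc_pauliZ_mul_self q)
    (loc_pauliX_mul_loc_pauliZ q)] at h
  exact h.of_smul

end OneQubitGates

section ControlledNot

variable {ι R : Type} [Fintype ι] [DecidableEq ι] [Fintype R] [DecidableEq R] {e : ι ↪ R} {a : R}

/-- The controlled Pauli `X` on the qubit `q`, with the qubit `p` as control. -/
def cnot (p q : ι) : Op ι := controlled (specProj (loc p pauliZ) false) (loc q pauliX)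

theorem exists_byproduct_mul_eq_smul_controlled {X Z : Op ι} (hX : X * X = 1) (hZ : Z * Z = 1)
    (hXZ : Commute X Z) (s t : Bool) :
    ∃ c : ℂ, (if s then 1 else Z) * (if t then 1 else X) *
      ((1 / 4 : ℂ) • ((1 : ℂ) • 1 + sgn s • X + sgn t • Z + (-(sgn s * sgn t)) • (X * Z))) =
        c • controlled (specProj Z false) X := by
  have hXZX : X * (X * Z) = Z := by rw [← mul_assoc, hX, one_mul]
  have hZXZ : Z * (X * Z) = X := by rw [← mul_assoc, ← hXZ.eq, mul_assoc, hZ, mul_one]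
  refine ⟨if s then 1 / 2 else sgn t / 2, ?_⟩
  cases s <;> cases t <;>
    simp only [controlled, specProj, sgn_true, sgn_false, mul_smul_comm, smul_mul_assoc, mul_add,
      add_mul, mul_assoc, hX, hZ, hXZX, hZXZ, ← hXZ.eq, one_mul, mul_one, if_true,
      Bool.false_eq_true, if_false] <;>
    module

theorem Simulable.cnot (ha : a ∉ Set.range e) {p q : ι} (hpq : p ≠ q) :
    Simulable e a (MBQC.cnot p q) := by
  refine Realizable.measure (canMeasure_loc_pauliZ a) fun w =>
    Realizable.measure (canMeasure_embed_pauliZ_mul_loc_pauliX ha p) fun s =>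
    Realizable.measure (canMeasure_embed_pauliX_mul_loc_pauliZ ha q) fun r =>
    Realizable.measure (canMeasure_loc_pauliX a) fun t => ?_
  have hV : Simulable e a ((if r == w then 1 else loc p MBQC.pauliZ) *
      if s == t then 1 else loc q MBQC.pauliX) := by
    refine .mul ha ?_ ?_ <;> split
    exacts [.one, .pauliZ ha p, .one, .pauliX ha q]
  obtain ⟨c, hc⟩ := exists_byproduct_mul_eq_smul_controlled (loc_pauliX_mul_self q)
    (loc_pauliZ_mul_self p) (commute_loc hpq.symm _ _) (r == w) (s == t)
  have hZ : specProj MBQC.pauliX t * MBQC.pauliZ * specProj MBQC.pauliZ w =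
      sgn w • (specProj MBQC.pauliX t * specProj MBQC.pauliZ w) := by
    rw [mul_assoc, mul_specProj pauliZ_mul_self, mul_smul_comm]
  have hX : specProj MBQC.pauliX t * MBQC.pauliX * specProj MBQC.pauliZ w =
      sgn t • (specProj MBQC.pauliX t * specProj MBQC.pauliZ w) := by
    rw [specProj_mul pauliX_mul_self, smul_mul_assoc]
  have hZX : specProj MBQC.pauliX t * (MBQC.pauliZ * MBQC.pauliX) * specProj MBQC.pauliZ w =
      (-(sgn w * sgn t)) • (specProj MBQC.pauliX t * specProj MBQC.pauliZ w) := by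
    rw [← neg_eq_iff_eq_neg.mpr pauliX_mul_pauliZ, mul_neg, neg_mul, ← mul_assoc,
      specProj_mul pauliX_mul_self, mul_assoc, mul_specProj pauliZ_mul_self, smul_mul_smul_comm,
      neg_smul, mul_comm]
  have hop := loc_mul_specProj_mul_specProj_mul_loc ha (one_smul ℂ _).symm hZ hX hZX
    (loc q MBQC.pauliX) (loc p MBQC.pauliZ) r s
  rw [mul_neg, mul_mul_mul_comm, sgn_mul_sgn, sgn_mul_sgn, map_specProj, map_specProj] at hop
  simp only [Set.mem_ofPred_eq, mul_assoc] at hop ⊢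
  rw [hop]
  exact hV.correct ha hc _

end ControlledNot

section UnitaryGroup

variable {n : Type*} [Fintype n] [DecidableEq n] {G : Subgroup (Matrix.unitaryGroup n ℂ)}

/-- The diagonal unitary matrix with the phases `exp (i f x)`. -/
def phaseDiagonal (f : n → ℝ) : Matrix.unitaryGroup n ℂ :=
  ⟨Matrix.diagonal fun x => Complex.exp (f x * Complex.I), by
    rw [Matrix.mem_unitaryGroup_iff, Matrix.star_eq_conjTranspose, Matrix.diagonal_conjTranspose,
      Matrix.diagonal_mul_diagonal, ← Matrix.diagonal_one]
    congr 1
    ext x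
    simp [RCLike.mul_conj, Complex.norm_exp_ofReal_mul_I]⟩

theorem coe_phaseDiagonal (f : n → ℝ) :
    (phaseDiagonal f : Matrix n n ℂ) = Matrix.diagonal fun x => Complex.exp (f x * Complex.I) :=
  rfl

theorem phaseDiagonal_zero : phaseDiagonal (0 : n → ℝ) = 1 :=
  Subtype.ext (by simp [coe_phaseDiagonal])

theorem phaseDiagonal_add (f g : n → ℝ) :
    phaseDiagonal (f + g) = phaseDiagonal f * phaseDiagonal g :=
  Subtype.ext (by simp [coe_phaseDiagonal, add_mul, Complex.exp_add])

theorem inv_phaseDiagonal (f : n → ℝ) : (phaseDiagonal f)⁻¹ = phaseDiagonal (-f) := by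
  rw [inv_eq_iff_mul_eq_one, ← phaseDiagonal_add, add_neg_cancel, phaseDiagonal_zero]

theorem exists_eq_phaseDiagonal {U : Matrix.unitaryGroup n ℂ} (hU : (U : Matrix n n ℂ).IsDiag) :
    ∃ f, U = phaseDiagonal f := by
  obtain ⟨d, hd⟩ : ∃ d, Matrix.diagonal d = (U : Matrix n n ℂ) := ⟨_, hU.diagonal_diag⟩
  refine ⟨fun x => (d x).arg, Subtype.ext ?_⟩
  have hUU := Matrix.mem_unitaryGroup_iff.mp U.2
  rw [← hd, Matrix.star_eq_conjTranspose, Matrix.diagonal_conjTranspose,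
    Matrix.diagonal_mul_diagonal, ← Matrix.diagonal_one] at hUU
  rw [← hd, coe_phaseDiagonal]
  congr 1
  ext x
  have hx : ‖d x‖ = 1 := by
    have h := congrFun (Matrix.diagonal_injective hUU) x
    rw [Pi.star_apply, Complex.star_def, Complex.mul_conj'] at h
    exact (pow_eq_one_iff_of_nonneg (norm_nonneg _) two_ne_zero).mp (by exact_mod_cast h)
  simpa [hx] using (Complex.norm_mul_exp_arg_mul_I (d x)).symm

/-- The vectors of phases `f` for which `G` contains the diagonal matrices with the phases
`exp (i α f x)` for all real `α`. -/
def phases (G : Subgroup (Matrix.unitaryGroup n ℂ)) : Submodule ℝ (n → ℝ) where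
  carrier := {f | ∀ α : ℝ, phaseDiagonal (α • f) ∈ G}
  zero_mem' α := by simp [phaseDiagonal_zero]
  add_mem' hf hg α := by
    rw [smul_add, phaseDiagonal_add]
    exact mul_mem (hf α) (hg α)
  smul_mem' c f hf α := by
    rw [smul_smul]
    exact hf (α * c)

theorem comp_mem_phases {P : Matrix.unitaryGroup n ℂ} (hP : P ∈ G) {σ : n → n}
    (hσ : ∀ (v : n → ℂ) (x : n), ((P : Matrix n n ℂ) *ᵥ v) x = v (σ x)) {f : n → ℝ}
    (hf : f ∈ phases G) : f ∘ σ ∈ phases G := by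
  intro α
  have hconj : P * phaseDiagonal (α • f) = phaseDiagonal (α • (f ∘ σ)) * P := by
    refine Subtype.ext (Matrix.ext_iff_mulVec.mpr fun v => funext fun x => ?_)
    simp [coe_phaseDiagonal, ← Matrix.mulVec_mulVec, hσ, Matrix.mulVec_diagonal]
  rw [← mul_inv_eq_iff_eq_mul.mpr hconj]
  exact mul_mem (mul_mem hP (hf α)) (inv_mem hP)

theorem mem_of_coe_eq_one_add_smul_vecMulVec (hdiag : ∀ f, phaseDiagonal f ∈ G)
    {R W : Matrix.unitaryGroup n ℂ} {κ c : ℂ} {d : n → ℂ} {x : n}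
    (hR : (R : Matrix n n ℂ) = 1 + κ • Matrix.vecMulVec d (star d)) (hW : W ∈ G)
    (hWd : (W : Matrix n n ℂ) *ᵥ d = Pi.single x c) : R ∈ G := by
  have hdW : star d ᵥ* star (W : Matrix n n ℂ) = star (Pi.single x c) := by
    rw [← hWd, Matrix.star_mulVec, Matrix.star_eq_conjTranspose]
  have hconj : ((W * R * W⁻¹ : Matrix.unitaryGroup n ℂ) : Matrix n n ℂ) =
      1 + κ • Matrix.vecMulVec (Pi.single x c) (star (Pi.single x c)) := by
    simp only [Matrix.UnitaryGroup.mul_val, Matrix.UnitaryGroup.inv_val, hR, mul_add, add_mul,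
      mul_one, Matrix.mem_unitaryGroup_iff.mp W.2, mul_smul_comm, smul_mul_assoc,
      Matrix.mul_vecMulVec, Matrix.vecMulVec_mul, hWd, hdW]
  have hisDiag : ((W * R * W⁻¹ : Matrix.unitaryGroup n ℂ) : Matrix n n ℂ).IsDiag := by
    intro i j hij
    rw [hconj]
    simp only [Matrix.add_apply, Matrix.one_apply_ne hij, Matrix.smul_apply,
      Matrix.vecMulVec_apply, Pi.star_apply, Pi.single_apply, smul_eq_mul]
    grind [star_zero]
  obtain ⟨f, hf⟩ := exists_eq_phaseDiagonal hisDiag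
  have hRW : R = W⁻¹ * phaseDiagonal f * W := by
    rw [← hf]
    group
  rw [hRW]
  exact mul_mem (mul_mem (inv_mem hW) (hdiag f)) hW

theorem one_add_smul_vecMulVec_mem_unitaryGroup {κ : ℂ} {d : n → ℂ}
    (h : κ + star κ + κ * star κ * (star d ⬝ᵥ d) = 0) :
    1 + κ • Matrix.vecMulVec d (star d) ∈ Matrix.unitaryGroup n ℂ := by
  have hstar : star (κ • Matrix.vecMulVec d (star d)) = star κ • Matrix.vecMulVec d (star d) := by
    rw [star_smul, Matrix.star_eq_conjTranspose, Matrix.conjTranspose_vecMulVec, star_star]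
  rw [Matrix.mem_unitaryGroup_iff, star_add, star_one, hstar, mul_add, add_mul, add_mul, one_mul,
    one_mul, mul_one, smul_mul_smul_comm, Matrix.vecMulVec_mul_vecMulVec, Matrix.vecMulVec_smul]
  trans 1 + (κ + star κ + κ * star κ * (star d ⬝ᵥ d)) • Matrix.vecMulVec d (star d)
  · module
  · rw [h, zero_smul, add_zero]

open scoped ComplexOrder in
theorem exists_reflection_mulVec_eq {e v : n → ℂ} (hev : star e ⬝ᵥ e = star v ⬝ᵥ v) :
    ∃ (R : Matrix.unitaryGroup n ℂ) (κ : ℂ),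
      (R : Matrix n n ℂ) = 1 + κ • Matrix.vecMulVec (v - e) (star (v - e)) ∧
        (R : Matrix n n ℂ) *ᵥ e = v := by
  set s := star (v - e) ⬝ᵥ e with hs
  have hd : star (v - e) ⬝ᵥ (v - e) = -(s + star s) := by
    rw [hs, ← Matrix.star_dotProduct, star_sub, sub_dotProduct, sub_dotProduct, dotProduct_sub,
      dotProduct_sub, hev]
    ring
  have hunitary : s⁻¹ + star s⁻¹ + s⁻¹ * star s⁻¹ * (star (v - e) ⬝ᵥ (v - e)) = 0 := by
    rw [hd, star_inv₀]
    rcases eq_or_ne s 0 with h | h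
    · simp [h]
    · have h' : star s ≠ 0 := star_ne_zero.mpr h
      field_simp
      ring
  refine ⟨⟨_, one_add_smul_vecMulVec_mem_unitaryGroup hunitary⟩, s⁻¹, rfl, ?_⟩
  rw [Matrix.add_mulVec, Matrix.one_mulVec, Matrix.smul_mulVec, Matrix.vecMulVec_mulVec, ← hs]
  rcases eq_or_ne s 0 with h | h
  · have hve : v - e = 0 := dotProduct_star_self_eq_zero.mp (by
      rw [hd, h, star_zero, add_zero, neg_zero])
    simp [sub_eq_zero.mp hve]
  · simp [h]

theorem mem_of_mulVec_single_eq (hdiag : ∀ f, phaseDiagonal f ∈ G)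
    (htrans : ∀ v : n → ℂ, ∃ W ∈ G, ∃ x c, (W : Matrix n n ℂ) *ᵥ v = Pi.single x c) (T : Finset n)
    {U : Matrix.unitaryGroup n ℂ}
    (hU : ∀ x ∉ T, (U : Matrix n n ℂ) *ᵥ Pi.single x 1 = Pi.single x 1) : U ∈ G := by
  induction T using Finset.induction_on generalizing U with
  | empty =>
    have hU1 : U = 1 := Subtype.ext (Matrix.ext_of_mulVec_single fun x =>
      (hU x (Finset.notMem_empty x)).trans (Matrix.one_mulVec _).symm)
    exact hU1 ▸ one_mem G
  | insert x T hx ih =>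
    have hinner (v w : n → ℂ) :
        star ((U : Matrix n n ℂ) *ᵥ v) ⬝ᵥ ((U : Matrix n n ℂ) *ᵥ w) = star v ⬝ᵥ w := by
      rw [Matrix.star_mulVec, ← Matrix.dotProduct_mulVec, Matrix.mulVec_mulVec,
        ← Matrix.star_eq_conjTranspose, Matrix.mem_unitaryGroup_iff'.mp U.2, Matrix.one_mulVec]
    set u := (U : Matrix n n ℂ) *ᵥ Pi.single x 1 with hu
    obtain ⟨R, κ, hR, hRu⟩ := exists_reflection_mulVec_eq (hinner (Pi.single x 1) (Pi.single x 1))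
    obtain ⟨W, hW, z, c, hWd⟩ := htrans (Pi.single x 1 - u)
    have hRG : R ∈ G := mem_of_coe_eq_one_add_smul_vecMulVec hdiag hR hW hWd
    suffices R * U ∈ G from (mul_mem_cancel_left hRG).mp this
    refine ih fun y hy => ?_
    rw [Matrix.UnitaryGroup.mul_val, ← Matrix.mulVec_mulVec]
    rcases eq_or_ne y x with rfl | hyx
    · exact hRu
    have hUy := hU y (by simp [hy, hyx])
    have horth : star u ⬝ᵥ Pi.single y 1 = 0 := by
      rw [← hUy, hu, hinner]
      simp [hyx.symm]
    rw [hUy, hR, Matrix.add_mulVec, Matrix.one_mulVec, Matrix.smul_mulVec,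
      Matrix.vecMulVec_mulVec, star_sub, sub_dotProduct, horth]
    simp [hyx]

/-- Such a group contains all complex reflections, and these generate the unitary group. -/
theorem eq_top_of_exists_mulVec_eq_single (hdiag : ∀ f, phaseDiagonal f ∈ G)
    (htrans : ∀ v : n → ℂ, ∃ W ∈ G, ∃ x c, (W : Matrix n n ℂ) *ᵥ v = Pi.single x c) : G = ⊤ :=
  (Subgroup.eq_top_iff' G).mpr fun _ =>
    mem_of_mulVec_single_eq hdiag htrans Finset.univ fun x hx => absurd (Finset.mem_univ x) hx

end UnitaryGroup

section Parity

variable {ι : Type}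

/-- The eigenvalue of `Z` on the qubit `q` for the basis state `x`. -/
def bitSign (q : ι) (x : ι → Fin 2) : ℝ := (-1) ^ (x q : ℕ)

/-- The parity of the qubits in `s`, written multiplicatively. These are the Walsh functions. -/
def parity (s : Finset ι) (x : ι → Fin 2) : ℝ := ∏ q ∈ s, bitSign q x

theorem sum_parity_mul_parity [Fintype ι] (x y : ι → Fin 2) :
    ∑ s, parity s x * parity s y = if x = y then 2 ^ Fintype.card ι else 0 := by
  have hprod : ∑ s, parity s x * parity s y = ∏ q, (1 + bitSign q x * bitSign q y) := by
    simp only [Finset.prod_one_add, Finset.powerset_univ, parity, Finset.prod_mul_distrib]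
  rw [hprod]
  split_ifs with h
  · have hone (q : ι) : 1 + bitSign q x * bitSign q y = 2 := by
      rw [h, bitSign, ← mul_pow]
      norm_num
    simp [hone]
  · obtain ⟨q, hq⟩ := Function.ne_iff.mp h
    refine Finset.prod_eq_zero (Finset.mem_univ q) ?_
    rw [bitSign, bitSign]
    generalize x q = a, y q = b at hq
    fin_cases a <;> fin_cases b <;> simp at hq ⊢

theorem span_range_parity [Finite ι] :
    Submodule.span ℝ (Set.range (parity : Finset ι → (ι → Fin 2) → ℝ)) = ⊤ := by
  classical
  have := Fintype.ofFinite ι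
  refine eq_top_iff.mpr fun f _ => ?_
  have hf : f = ∑ s, (∑ x, f x / 2 ^ Fintype.card ι * parity s x) • parity s := by
    ext y
    simp only [Finset.sum_apply, Pi.smul_apply, smul_eq_mul, Finset.sum_mul]
    rw [Finset.sum_comm]
    simp only [mul_assoc, ← Finset.mul_sum, sum_parity_mul_parity]
    simp
  rw [hf]
  exact Submodule.sum_mem _ fun s _ => Submodule.smul_mem _ _ (Submodule.subset_span ⟨s, rfl⟩)

variable [DecidableEq ι]

/-- The basis state that differs from `x` in the qubit `q`. -/
def flipBit (q : ι) (x : ι → Fin 2) : ι → Fin 2 := Function.update x q (x q + 1)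

/-- The action of the gate `cnot p q` on the basis states. -/
def cnotMap (p q : ι) (x : ι → Fin 2) : ι → Fin 2 := Function.update x q (x q + x p)

theorem flipBit_flipBit (q : ι) (x : ι → Fin 2) : flipBit q (flipBit q x) = x := by
  have htwo : x q + 1 + 1 = x q := by
    generalize x q = b
    fin_cases b <;> rfl
  rw [flipBit, flipBit, Function.update_idem, Function.update_self, htwo, Function.update_eq_self]

theorem bitSign_flipBit (q : ι) (x : ι → Fin 2) : bitSign q (flipBit q x) = -bitSign q x := by
  rw [bitSign, bitSign, flipBit, Function.update_self]
  generalize x q = b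
  fin_cases b <;> simp

theorem bitSign_cnotMap_self (p q : ι) (x : ι → Fin 2) :
    bitSign q (cnotMap p q x) = bitSign q x * bitSign p x := by
  rw [bitSign, bitSign, bitSign, cnotMap, Function.update_self]
  generalize x q = a, x p = b
  fin_cases a <;> fin_cases b <;> simp

theorem bitSign_cnotMap_of_ne (p : ι) {q r : ι} (h : r ≠ q) (x : ι → Fin 2) :
    bitSign r (cnotMap p q x) = bitSign r x := by
  rw [bitSign, bitSign, cnotMap, Function.update_of_ne h]

theorem parity_comp_cnotMap {s : Finset ι} {p q : ι} (hp : p ∉ s) (hq : q ∈ s) :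
    parity s ∘ cnotMap p q = parity (insert p s) := by
  ext x
  have hrest : ∏ r ∈ s.erase q, bitSign r (cnotMap p q x) = ∏ r ∈ s.erase q, bitSign r x :=
    Finset.prod_congr rfl fun r hr => bitSign_cnotMap_of_ne p (Finset.ne_of_mem_erase hr) x
  rw [Function.comp_apply, parity, parity, Finset.prod_insert hp, ← Finset.mul_prod_erase _ _ hq,
    ← Finset.mul_prod_erase _ _ hq, bitSign_cnotMap_self, hrest]
  ring

variable [Fintype ι]

theorem isSelfAdjoint_loc_pauliX (q : ι) : IsSelfAdjoint (loc q pauliX) :=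
  IsSelfAdjoint.map pauliX_isHermitian (loc q)

theorem isSelfAdjoint_loc_pauliZ (q : ι) : IsSelfAdjoint (loc q pauliZ) :=
  IsSelfAdjoint.map pauliZ_isHermitian (loc q)

theorem loc_pauliX_mulVec (q : ι) (v : Vec ι) (x : ι → Fin 2) :
    (loc q pauliX *ᵥ v) x = v (flipBit q x) := by
  rw [loc_mulVec, Fin.sum_univ_two, flipBit]
  generalize x q = b
  fin_cases b <;> simp [pauliX]

theorem phaseGate_loc_pauliX_mulVec (q : ι) (u : ℂ) (v : Vec ι) (x : ι → Fin 2) :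
    (phaseGate (loc q pauliX) u *ᵥ v) x = (1 + u) / 2 * v x + (1 - u) / 2 * v (flipBit q x) := by
  simp only [phaseGate, specProj, Matrix.add_mulVec, Matrix.smul_mulVec, Matrix.one_mulVec,
    Pi.add_apply, Pi.smul_apply, loc_pauliX_mulVec, smul_eq_mul, sgn_true, sgn_false]
  ring

theorem phaseGate_loc_pauliZ (q : ι) (u : ℂ) :
    phaseGate (loc q pauliZ) u = Matrix.diagonal fun x => u ^ (x q : ℕ) := by
  have hZ : phaseGate pauliZ u = Matrix.diagonal fun b : Fin 2 => u ^ (b : ℕ) := by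
    ext i j
    fin_cases i <;> fin_cases j <;> norm_num [phaseGate, specProj, pauliZ, ← mul_add]
  rw [← map_phaseGate, hZ, loc_diagonal]

theorem cnot_mulVec (p q : ι) (v : Vec ι) (x : ι → Fin 2) :
    (cnot p q *ᵥ v) x = v (cnotMap p q x) := by
  have hP : specProj pauliZ false = Matrix.diagonal ![0, 1] := by
    ext i j
    fin_cases i <;> fin_cases j <;> norm_num [specProj, pauliZ]
  rw [cnot, controlled, ← map_specProj, hP, loc_diagonal, Matrix.add_mulVec, Matrix.sub_mulVec,
    Matrix.one_mulVec, ← Matrix.mulVec_mulVec, Pi.add_apply, Pi.sub_apply, Matrix.mulVec_diagonal,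
    Matrix.mulVec_diagonal, loc_pauliX_mulVec, cnotMap, flipBit]
  generalize x p = b
  fin_cases b <;> simp

theorem commute_specProj_loc_pauliZ_loc_pauliX {p q : ι} (hpq : p ≠ q) (s : Bool) :
    Commute (specProj (loc p pauliZ) s) (loc q pauliX) := by
  rw [← map_specProj]
  exact commute_loc hpq _ _

theorem isSelfAdjoint_cnot {p q : ι} (hpq : p ≠ q) : IsSelfAdjoint (cnot p q) :=
  isSelfAdjoint_controlled (isStarProjection_specProj (loc_pauliZ_mul_self p)
    (isSelfAdjoint_loc_pauliZ p) false).isSelfAdjoint (isSelfAdjoint_loc_pauliX q)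
    (commute_specProj_loc_pauliZ_loc_pauliX hpq false)

theorem cnot_mem_unitaryGroup {p q : ι} (hpq : p ≠ q) :
    cnot p q ∈ Matrix.unitaryGroup (ι → Fin 2) ℂ :=
  controlled_mem_unitary (isStarProjection_specProj (loc_pauliZ_mul_self p)
    (isSelfAdjoint_loc_pauliZ p) false) (loc_pauliX_mul_self q) (isSelfAdjoint_loc_pauliX q)
    (commute_specProj_loc_pauliZ_loc_pauliX hpq false)

end Parity

section Gates

variable {ι R : Type} [Fintype ι] [DecidableEq ι] [Fintype R] [DecidableEq R] {e : ι ↪ R} {a : R}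

/-- The group of the unitary operators that are simulable together with their inverses. -/
def gates (ha : a ∉ Set.range e) : Subgroup (Matrix.unitaryGroup (ι → Fin 2) ℂ) where
  carrier := {U | Simulable e a (U : Op ι) ∧ Simulable e a (↑U⁻¹ : Op ι)}
  one_mem' := by
    rw [Set.mem_ofPred_eq, inv_one, Matrix.UnitaryGroup.one_val]
    exact ⟨.one, .one⟩
  mul_mem' {U V} hU hV := by
    rw [Set.mem_ofPred_eq, mul_inv_rev, Matrix.UnitaryGroup.mul_val, Matrix.UnitaryGroup.mul_val]
    exact ⟨hU.1.mul ha hV.1, hV.2.mul ha hU.2⟩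
  inv_mem' {U} hU := by
    rw [Set.mem_ofPred_eq, inv_inv]
    exact hU.symm

theorem mk_phaseGate_pauliX_mem_gates (ha : a ∉ Set.range e) (q : ι) {u : ℂ} (hu : ‖u‖ = 1) :
    (⟨phaseGate (loc q pauliX) u, phaseGate_mem_unitary (loc_pauliX_mul_self q)
      (isSelfAdjoint_loc_pauliX q) hu⟩ : Matrix.unitaryGroup (ι → Fin 2) ℂ) ∈ gates ha := by
  refine ⟨.phaseGate_pauliX ha q hu, ?_⟩
  rw [Matrix.UnitaryGroup.inv_val, star_phaseGate (loc_pauliX_mul_self q)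
    (isSelfAdjoint_loc_pauliX q)]
  exact .phaseGate_pauliX ha q ((norm_star u).trans hu)

theorem mk_cnot_mem_gates (ha : a ∉ Set.range e) {p q : ι} (hpq : p ≠ q) :
    ⟨cnot p q, cnot_mem_unitaryGroup hpq⟩ ∈ gates ha := by
  refine ⟨.cnot ha hpq, ?_⟩
  rw [Matrix.UnitaryGroup.inv_val, (isSelfAdjoint_cnot hpq).star_eq]
  exact .cnot ha hpq

theorem mem_phases_gates (ha : a ∉ Set.range e) {f : (ι → Fin 2) → ℝ}
    (hf : ∀ α : ℝ, Simulable e a (phaseDiagonal (α • f) : Op ι)) : f ∈ phases (gates ha) := by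
  refine fun α => ⟨hf α, ?_⟩
  rw [inv_phaseDiagonal, ← neg_smul]
  exact hf (-α)

theorem one_mem_phases_gates (ha : a ∉ Set.range e) : 1 ∈ phases (gates ha) := by
  refine mem_phases_gates ha fun α =>
    Simulable.of_smul (c := Complex.exp (-(α * Complex.I))) ?_
  have hone : Complex.exp (-(α * Complex.I)) •
      (phaseDiagonal (α • (1 : (ι → Fin 2) → ℝ)) : Op ι) = 1 := by
    rw [coe_phaseDiagonal, ← Matrix.diagonal_smul, ← Matrix.diagonal_one]
    congr 1
    ext x
    simp [← Complex.exp_add]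
  rw [hone]
  exact .one

theorem bitSign_mem_phases_gates (ha : a ∉ Set.range e) (q : ι) :
    bitSign q ∈ phases (gates ha) := by
  refine mem_phases_gates ha fun α =>
    Simulable.of_smul (c := Complex.exp (-(α * Complex.I))) ?_
  have hgate : Complex.exp (-(α * Complex.I)) • (phaseDiagonal (α • bitSign q) : Op ι) =
      phaseGate (loc q pauliZ) (Complex.exp ((-2 * α : ℝ) * Complex.I)) := by
    rw [coe_phaseDiagonal, phaseGate_loc_pauliZ, ← Matrix.diagonal_smul]
    congr 1
    ext x
    rw [Pi.smul_apply, Pi.smul_apply, smul_eq_mul, ← Complex.exp_add, ← Complex.exp_nat_mul,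
      bitSign]
    generalize x q = b
    congr 1
    fin_cases b <;> norm_num
    ring
  rw [hgate]
  exact .phaseGate_pauliZ ha q (Complex.norm_exp_ofReal_mul_I _)

theorem parity_mem_phases_gates (ha : a ∉ Set.range e) (s : Finset ι) :
    parity s ∈ phases (gates ha) := by
  induction s using Finset.induction_on with
  | empty => exact one_mem_phases_gates ha
  | insert p s hp ih =>
    rcases s.eq_empty_or_nonempty with rfl | ⟨q, hq⟩
    · have hsingle : parity {p} = bitSign p := funext fun _ => Finset.prod_singleton _ _
      exact hsingle ▸ bitSign_mem_phases_gates ha p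
    · rw [← parity_comp_cnotMap hp hq]
      exact comp_mem_phases (mk_cnot_mem_gates ha (ne_of_mem_of_not_mem hq hp).symm)
        (cnot_mulVec p q) ih

theorem phaseDiagonal_mem_gates (ha : a ∉ Set.range e) (f : (ι → Fin 2) → ℝ) :
    phaseDiagonal f ∈ gates ha := by
  have hspan : Submodule.span ℝ (Set.range parity) ≤ phases (gates ha) :=
    Submodule.span_le.mpr (Set.range_subset_iff.mpr (parity_mem_phases_gates ha))
  rw [span_range_parity] at hspan
  exact one_smul ℝ f ▸ hspan (Submodule.mem_top (x := f)) 1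

theorem exists_mem_gates_mulVec_eq_cos_add_sin (ha : a ∉ Set.range e) (q : ι)
    {τ : (ι → Fin 2) → ℝ} (hτ : ∀ x, τ (flipBit q x) = τ x) :
    ∃ W ∈ gates ha, ∀ (v : Vec ι) (x : ι → Fin 2), ((W : Op ι) *ᵥ v) x =
      (τ x).cos * v x + bitSign q x * (τ x).sin * v (flipBit q x) := by
  refine ⟨_, mul_mem (mul_mem (mk_phaseGate_pauliX_mem_gates ha q (u := -Complex.I) (by simp))
    (phaseDiagonal_mem_gates ha fun x => bitSign q x * τ x))
    (mk_phaseGate_pauliX_mem_gates ha q Complex.norm_I), fun v x => ?_⟩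
  simp only [Matrix.UnitaryGroup.mul_val, ← Matrix.mulVec_mulVec, phaseGate_loc_pauliX_mulVec,
    coe_phaseDiagonal, Matrix.mulVec_diagonal, flipBit_flipBit, bitSign_flipBit, hτ, neg_mul]
  obtain h | h : bitSign q x = 1 ∨ bitSign q x = -1 := neg_one_pow_eq_or ℝ _
  all_goals
    simp only [h, Complex.exp_mul_I, one_mul, neg_mul, neg_neg]
    push_cast
    simp only [Complex.cos_neg, Complex.sin_neg]
    grind [Complex.I_sq]

theorem cos_arg_mul_im (z : ℂ) : z.arg.cos * z.im = z.arg.sin * z.re := by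
  rcases eq_or_ne z 0 with rfl | hz
  · simp
  · rw [Complex.cos_arg hz, Complex.sin_arg]
    ring

theorem exists_mem_gates_mulVec_eq_zero (ha : a ∉ Set.range e) (q : ι) (v : Vec ι) :
    ∃ W ∈ gates ha, (∀ x : ι → Fin 2, x q = 1 → ((W : Op ι) *ᵥ v) x = 0) ∧
      ∀ x, v x = 0 → v (flipBit q x) = 0 → ((W : Op ι) *ᵥ v) x = 0 := by
  let z (x : ι → Fin 2) : ℂ := ⟨‖v (Function.update x q 0)‖, ‖v (Function.update x q 1)‖⟩
  have hz (x : ι → Fin 2) : z (flipBit q x) = z x := by simp [z, flipBit]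
  obtain ⟨W, hW, hWv⟩ := exists_mem_gates_mulVec_eq_cos_add_sin ha q (τ := fun x => (z x).arg)
    fun x => by rw [hz]
  have hnorm :
      ((phaseDiagonal fun x => -(v x).arg : Matrix.unitaryGroup _ ℂ) : Op ι) *ᵥ v =
        fun x => (‖v x‖ : ℂ) := by
    ext x
    rw [coe_phaseDiagonal, Matrix.mulVec_diagonal]
    nth_rw 2 [← Complex.norm_mul_exp_arg_mul_I (v x)]
    rw [mul_left_comm, ← Complex.exp_add]
    simp
  refine ⟨W * phaseDiagonal fun x => -(v x).arg, mul_mem hW (phaseDiagonal_mem_gates ha _),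
    fun x hx => ?_, fun x hx hx' => ?_⟩ <;>
    rw [Matrix.UnitaryGroup.mul_val, ← Matrix.mulVec_mulVec, hnorm, hWv]
  · have hre : (z x).re = ‖v (flipBit q x)‖ := by simp [z, flipBit, hx]
    have him : (z x).im = ‖v x‖ := by simp [z, ← hx]
    have hsign : bitSign q x = -1 := by simp [bitSign, hx]
    rw [← hre, ← him, hsign]
    exact_mod_cast (by linarith [cos_arg_mul_im (z x)] :
      (z x).arg.cos * (z x).im + -1 * (z x).arg.sin * (z x).re = 0)
  · simp [hx, hx']

theorem exists_mem_gates_mulVec_eq_single (ha : a ∉ Set.range e) (v : Vec ι) :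
    ∃ W ∈ gates ha, ∃ x c, (W : Op ι) *ᵥ v = Pi.single x c := by
  have hzero (T : Finset ι) : ∃ W ∈ gates ha, ∀ x : ι → Fin 2, (∃ q ∈ T, x q = 1) →
      ((W : Op ι) *ᵥ v) x = 0 := by
    induction T using Finset.induction_on with
    | empty => exact ⟨1, one_mem _, by simp⟩
    | insert q T _ ih =>
      obtain ⟨W, hW, hWT⟩ := ih
      obtain ⟨V, hV, hVq, hVW⟩ := exists_mem_gates_mulVec_eq_zero ha q ((W : Op ι) *ᵥ v)
      refine ⟨V * W, mul_mem hV hW, fun x ⟨p, hp, hx⟩ => ?_⟩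
      rw [Matrix.UnitaryGroup.mul_val, ← Matrix.mulVec_mulVec]
      rcases eq_or_ne p q with rfl | hpq
      · exact hVq x hx
      · have hpT := Finset.mem_of_mem_insert_of_ne hp hpq
        refine hVW x (hWT x ⟨p, hpT, hx⟩) (hWT _ ⟨p, hpT, ?_⟩)
        rw [flipBit, Function.update_of_ne hpq, hx]
  obtain ⟨W, hW, hWv⟩ := hzero Finset.univ
  refine ⟨W, hW, 0, ((W : Op ι) *ᵥ v) 0, funext fun x => ?_⟩
  rcases eq_or_ne x 0 with rfl | hx
  · rw [Pi.single_eq_same]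
  · obtain ⟨q, hq⟩ := Function.ne_iff.mp hx
    rw [Pi.single_eq_of_ne hx]
    exact hWv x ⟨q, Finset.mem_univ q, Fin.eq_one_of_ne_zero _ hq⟩

theorem simulable_of_mem_unitaryGroup (ha : a ∉ Set.range e) {U : Op ι}
    (hU : U ∈ Matrix.unitaryGroup (ι → Fin 2) ℂ) : Simulable e a U := by
  have htop : gates ha = ⊤ := eq_top_of_exists_mulVec_eq_single (phaseDiagonal_mem_gates ha)
    (exists_mem_gates_mulVec_eq_single ha)
  have hmem : (⟨U, hU⟩ : Matrix.unitaryGroup (ι → Fin 2) ℂ) ∈ gates ha :=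
    htop ▸ Subgroup.mem_top _
  exact hmem.1

end Gates

section ControlledSpectralProjections

variable {A : Type*} [Ring A] [Algebra ℂ A] {P X Z : A}

theorem commute_specProj (h : Commute P Z) (s : Bool) : Commute P (specProj Z s) :=
  ((Commute.one_right P).add_right (h.smul_right _)).smul_right _

theorem specProj_mul_controlled_mul_specProj (hZ : Z * Z = 1) (hXZ : X * Z = -(Z * X))
    (hPZ : Commute P Z) (s : Bool) :
    specProj Z s * controlled P X * specProj Z s = (1 - P) * specProj Z s := by
  have hP := (commute_specProj hPZ s).eq
  have hidem := (isIdempotentElem_specProj hZ s).eq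
  rw [controlled, mul_add, add_mul, mul_sub, mul_one, sub_mul, sub_mul, one_mul, ← mul_assoc, ← hP,
    mul_assoc P, mul_assoc P, mul_assoc P, specProj_mul_mul_specProj_of_anticomm hZ hXZ, hidem,
    mul_zero, add_zero]

theorem specProj_not_mul_controlled_mul_specProj (hZ : Z * Z = 1) (hXZ : X * Z = -(Z * X))
    (hPZ : Commute P Z) (s : Bool) :
    specProj Z (!s) * controlled P X * specProj Z s = P * (X * specProj Z s) := by
  have hP := (commute_specProj hPZ (!s)).eq
  have hidem := (isIdempotentElem_specProj hZ s).eq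
  rw [controlled, mul_add, add_mul, mul_sub, mul_one, sub_mul, ← mul_assoc, ← hP, mul_assoc P,
    mul_assoc P, mul_assoc P, specProj_not_mul_specProj hZ, mul_zero, sub_zero, zero_add,
    ← mul_specProj_of_anticomm hXZ, mul_assoc, hidem]

end ControlledSpectralProjections

section TensorOps

variable {ι κ : Type} [Fintype ι] [DecidableEq ι] [Fintype κ] [DecidableEq κ]

/-- The operators that act as `A` on the first register and by some operator on the second one. -/
def tensorOps (κ : Type) [Fintype κ] [DecidableEq κ] (A : Op ι) : Set (Op (ι ⊕ κ)) :=
  {B | ∃ K : Op κ, ∀ φ χ, B *ᵥ tensorVec φ χ = tensorVec (A *ᵥ φ) (K *ᵥ χ)}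

theorem mul_mem_tensorOps {A A' : Op ι} {B B' : Op (ι ⊕ κ)} (hB : B ∈ tensorOps κ A)
    (hB' : B' ∈ tensorOps κ A') : B * B' ∈ tensorOps κ (A * A') := by
  obtain ⟨K, hK⟩ := hB
  obtain ⟨K', hK'⟩ := hB'
  refine ⟨K * K', fun φ χ => ?_⟩
  simp only [← Matrix.mulVec_mulVec, hK, hK']

theorem embed_inl_mem_tensorOps (A : Op ι) :
    embed Function.Embedding.inl A ∈ tensorOps κ A :=
  ⟨1, fun φ χ => by rw [embed_inl_mulVec_tensorVec, Matrix.one_mulVec]⟩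

theorem mul_loc_inr_mem_tensorOps {A : Op ι} {B : Op (ι ⊕ κ)} (hB : B ∈ tensorOps κ A) (q : κ)
    (M : Matrix (Fin 2) (Fin 2) ℂ) : B * loc (.inr q) M ∈ tensorOps κ A := by
  obtain ⟨K, hK⟩ := hB
  refine ⟨K * loc q M, fun φ χ => ?_⟩
  rw [← Matrix.mulVec_mulVec, ← Matrix.mulVec_mulVec, ← hK, ← embed_inr_mulVec_tensorVec,
    embed_loc]
  rfl

theorem simulates_of_realizable {J : Type} {F : Set (Σ k, Observable k)} {n m : ℕ}
    {A : J → Op (Fin n)} (h : Realizable F fun k => tensorOps (Fin m) (A k)) : Simulates F A := by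
  obtain ⟨P, hP, hPA⟩ := h
  refine ⟨m, P, hP.tendsto, fun k B hB χ => ?_⟩
  obtain ⟨K, hK⟩ := hPA k B hB
  exact ⟨K *ᵥ χ, fun φ => hK φ χ⟩

end TensorOps

section Universality

theorem simulates_of_mem_unitaryGroup {n : ℕ} {U : Op (Fin n)}
    (hU : U ∈ Matrix.unitaryGroup (Fin n → Fin 2) ℂ) : Simulates F2 fun _ : Unit => U := by
  have ha : (Sum.inr 0 : Fin n ⊕ Fin 1) ∉ Set.range Function.Embedding.inl := by simp
  refine simulates_of_realizable (m := 1) ((simulable_of_mem_unitaryGroup ha hU).mono ?_)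
  rintro _ _ ⟨K, rfl⟩
  exact mul_loc_inr_mem_tensorOps (embed_inl_mem_tensorOps U) 0 K

variable {ι : Type} [Fintype ι] [DecidableEq ι]

/-- The embedding of `ι` and of an ancilla `none`, which leaves out the qubit `inr 1`. -/
def optionEmbedding (ι : Type) : Option ι ↪ ι ⊕ Fin 2 :=
  ⟨fun o => o.elim (.inr 0) .inl, by rintro (_ | _) (_ | _) <;> simp⟩

theorem realizable_controlled {p : Op ι} (hp : IsStarProjection p) :
    Realizable F2 fun _ : Unit => {B | ∃ K, B =
      controlled (embed Function.Embedding.inl p) (loc (.inr 0) pauliX) *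
        loc (.inr 1 : ι ⊕ Fin 2) K} := by
  have ha : (Sum.inr 1 : ι ⊕ Fin 2) ∉ Set.range (optionEmbedding ι) := by
    rintro ⟨_ | i, h⟩
    · exact absurd (Sum.inr.inj h) (by decide)
    · exact absurd h Sum.inl_ne_inr
  have hV : controlled (embed Function.Embedding.some p) (loc none pauliX) ∈
      Matrix.unitaryGroup (Option ι → Fin 2) ℂ :=
    controlled_mem_unitary (hp.map _) (loc_pauliX_mul_self _) (isSelfAdjoint_loc_pauliX _)
      (commute_embed_loc _ (by simp) _ _)
  have hembed : embed (optionEmbedding ι)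
      (controlled (embed Function.Embedding.some p) (loc none pauliX)) =
      controlled (embed Function.Embedding.inl p) (loc (.inr 0) pauliX) := by
    simp only [controlled, map_add, map_sub, map_one, map_mul, embed_embed, embed_loc]
    rfl
  exact hembed ▸ simulable_of_mem_unitaryGroup ha hV

/-- The controlled gate copies the outcome of the measurement of `p` to the ancilla. -/
theorem realizable_projection {p : Op ι} (hp : IsStarProjection p) :
    Realizable F2 fun b : Bool => tensorOps (Fin 2) (if b then p else 1 - p) := by
  have hZ : Commute (embed Function.Embedding.inl p)
      (loc (.inr 0 : ι ⊕ Fin 2) pauliZ) := commute_embed_loc _ (by simp) _ _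
  refine Realizable.measure (canMeasure_loc_pauliZ (.inr 0)) fun s =>
    (realizable_controlled hp).bind fun _ =>
    Realizable.measure (canMeasure_loc_pauliZ (.inr 0)) fun t => .halt (k := t != s) ?_
  rintro _ ⟨K, rfl⟩
  rw [one_mul, Set.mem_ofPred_eq, mul_assoc, mul_assoc _ _ (specProj _ _),
    (commute_specProj (commute_loc (by simp) _ _) s).eq, ← mul_assoc, ← mul_assoc]
  obtain rfl | rfl : t = s ∨ t = !s := by cases s <;> cases t <;> simp
  · rw [specProj_mul_controlled_mul_specProj (loc_pauliZ_mul_self _)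
      (loc_pauliX_mul_loc_pauliZ _) hZ, ← map_specProj, bne_self_eq_false,
      if_neg Bool.false_ne_true]
    refine mul_loc_inr_mem_tensorOps (mul_loc_inr_mem_tensorOps ?_ _ _) _ _
    rw [← map_one (embed Function.Embedding.inl), ← map_sub]
    exact embed_inl_mem_tensorOps _
  · rw [specProj_not_mul_controlled_mul_specProj (loc_pauliZ_mul_self _)
      (loc_pauliX_mul_loc_pauliZ _) hZ, ← map_specProj, ← map_mul, if_pos (by simp)]
    exact mul_loc_inr_mem_tensorOps
      (mul_loc_inr_mem_tensorOps (embed_inl_mem_tensorOps _) _ _) _ _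

theorem realizable_option_projection {r : ℕ} {p : Fin r → Op ι} (hp : ∀ k, IsStarProjection (p k))
    (hsum : ∑ k, p k = 1) (s : Finset (Fin r)) :
    Realizable F2 fun o : Option (Fin r) =>
      tensorOps (Fin 2) (o.elim (1 - ∑ k ∈ s, p k) p) := by
  induction s using Finset.induction_on with
  | empty => exact .halt (k := none) ⟨1, by simp⟩
  | insert j s hj ih =>
    have horth : p j * ∑ k ∈ s, p k = 0 := by
      rw [Finset.mul_sum]
      exact Finset.sum_eq_zero fun k hk =>
        mul_eq_zero_of_sum_eq_one hp hsum (ne_of_mem_of_not_mem hk hj).symm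
    refine ih.bind fun o => ?_
    cases o with
    | some k => exact .halt (k := some k) fun B hB => (one_mul B).symm ▸ hB
    | none =>
      refine (realizable_projection (hp j)).bind fun b =>
        .halt (k := if b then some j else none) fun C hC B hB => ?_
      rw [one_mul]
      convert mul_mem_tensorOps hC hB using 2
      cases b
      · simp only [Bool.false_eq_true, if_false, Option.elim_none, Finset.sum_insert hj, sub_mul,
          mul_sub, one_mul, mul_one, horth]
        abel
      · simp only [if_true, Option.elim_none, Option.elim_some, mul_sub, mul_one, horth, sub_zero]

theorem simulates_of_isStarProjection {n r : ℕ} {p : Fin r → Op (Fin n)}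
    (hp : ∀ k, IsStarProjection (p k)) (hsum : ∑ k, p k = 1) : Simulates F2 p := by
  obtain ⟨k₀⟩ : Nonempty (Fin r) := by
    by_contra! h
    simp at hsum
  refine simulates_of_realizable (m := 2)
    ((realizable_option_projection hp hsum Finset.univ).bind fun o => .halt (k := o.getD k₀) ?_)
  rintro B ⟨K, hK⟩
  rw [one_mul]
  cases o with
  | some k => exact ⟨K, hK⟩
  | none => exact ⟨0, fun φ χ => by rw [hK]; ext; simp [tensorVec, hsum]⟩

end Universality

end MBQC

end

theorem theorem1 : MBQC.IsQuantumUniversal MBQC.F2 :=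
  fun _ => ⟨fun _ hU => MBQC.simulates_of_mem_unitaryGroup hU,
    fun _ _ hp hsum => MBQC.simulates_of_isStarProjection hp hsum⟩
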